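/- Binomial coefficients $\binom{a}{b}$ with integers $a,b$ are $0$ for $b<0$ and $a(a-1)\cdots(a-b+1)/b!$ for $b\ge 0$. For integers $r,s,x,y$ put $\phi_{r,s}(x,y)=\binom{s-r}{y-x}$ if $r<s$ and $\phi_{r,s}(x,y)=0$ otherwise. **The half-hexagon.** Let $n\ge 0$. Take the triangular lattice in skewed coordinates $(t,x)\in\mathbb Z^2$, with edges in the directions $(0,1)$, $(1,0)$, $(1,1)$. The order-$n$ Novak half-hexagon is the trapezoid $\{0\le t\le n+1,\ 1\le x\le n+1+t\}$ (sides $n$, $n+1$, $2n+1$, $n+1$) from which the $n+1$ unit triangles that have the segment from $(n+1,x)$ to $(n+1,x+1)$, $x=1,3,\dots,2n+1$, as a side are removed. A lozenge is the union of two unit triangles sharing a side, and a tiling is a set of lozenges in the region covering each of its unit triangles exactly once. A tiling has a *walker at time $t$ at position $x$* if the segment from $(t,x)$ to $(t,x+1)$ is a side of one of its lozenges (so the walkers are $n$ nonintersecting paths which start at $1,\dots,n$ at time $0$, stay or move one unit to the right at each step, and end at $2,4,\dots,2n$ at time $n+1$). **(1)** The set of tilings of the order-$n$ Novak half-hexagon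 is finite and nonempty, and the correlation functions of a uniformly random tiling are determinantal: for every $m\ge0$ and all pairwise distinct $(t_1,x_1),\dots,(t_m,x_m)$ with $t_a\in\{0,\dots,n+1\}$, $x_a\in\mathbb Z$, the probability that for each $a=1,\dots,m$ there is a walker at time $t_a$ at position $x_a$ equals $\det[K(t_a,x_a;t_b,x_b)]_{a,b=1}^m$, where $$K(r,x;s,y)=-\phi_{r,s}(x,y)+\sum_{i,j=1}^n\frac{\binom{n+1-r}{2i-x}\binom{s}{y-j}}{\binom{2n}{2i-1}}\sum_{k=1}^{j}\binom{2n}{k-1}\binom{n+j-k}{j-k}\frac{(-1)^{k+j+i+n}}{2^{n-1}(i-1)!\,(n-i)!}\prod_{l=1,\,l\ne i}^n(k-2l).$$ **(2)** More generally, let $n,N\ge 0$ and let $y_1,\dots,y_n$ be integers. Consider the configurations of $n$ walkers on $\mathbb Z$ at times $0,\dots,N$ that start at $1,\dots,n$, end at $y_1,\dots,y_n$, each stay or move one unit to the right at each step, and have strictly increasing positions $x^{(t)}_1<\dots<x^{(t)}_n$ at every time $t$. If there is at least one such configuration, then there are finitely many, and under the uniform distribution on them, for every $m\ge0$ and all pairwise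 distinct $(t_1,x_1),\dots,(t_m,x_m)$ with $t_a\in\{0,\dots,N\}$, $x_a\in\mathbb Z$, the probability that there is a walker at time $t_a$ at position $x_a$ for each $a$ equals $\det[K_{N,y}(t_a,x_a;t_b,x_b)]_{a,b=1}^m$, where $$K_{N,y}(r,x;s,z)=-\phi_{r,s}(x,z)+\sum_{i,j=1}^n\frac{\binom{N-r}{y_i-x}\binom{s}{z-j}}{\binom{N+n-1}{y_i-1}}\sum_{k=1}^{j}\binom{N+n-1}{k-1}\binom{N-1+j-k}{j-k}(-1)^{k+j}\prod_{l=1,\,l\ne i}^n\frac{k-y_l}{y_i-y_l}.$$ **(3)** For every $n\ge 0$ and all integers $r,x,s,y$, the kernel $K(r,x;s,y)$ of (1) is equal to $K_{N,(y_1,\dots,y_n)}(r,x;s,y)$ with $N=n+1$ and $y_i=2i$ for $i=1,\dots,n$. -/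

import Mathlib

namespace HalfHexagon

/-- The binomial coefficient `C(a, b)` for integers `a`, `b`, with the usual convention that it is
zero for `b < 0` (and hence also for `0 ≤ a < b`). -/
noncomputable def binom (a b : ℤ) : ℚ :=
  if 0 ≤ b then ((Ring.choose a b.toNat : ℤ) : ℚ) else 0

/-- `φ_{r,s}(x,y) = C(s - r, y - x)` for `r < s`, and `0` otherwise. -/
noncomputable def phi (r s x y : ℤ) : ℚ :=
  if r < s then binom (s - r) (y - x) else 0

/-- The probability of the event `E` under the uniform distribution on the finite nonempty
set `S`. -/
noncomputable def uniformProb {Ω : Type*} (S E : Set Ω) : ℚ :=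
  ((S ∩ E).ncard : ℚ) / (S.ncard : ℚ)

/-! ### Nonintersecting walkers -/

/-- The configurations of `n` nonintersecting walkers on the integer line, during the times
`0, …, N`: the walkers start densely packed at `1, …, n`, end at `y`, and at each tick of the clock
each of them stays or moves one step to the right. The `i`-th walker (in the numbering `1, …, n`)
has the index `i - 1` in `Fin n`. -/
def walks (n N : ℕ) (y : Fin n → ℤ) : Set (Fin (N + 1) → Fin n → ℤ) :=
  {w | (∀ t, StrictMono (w t)) ∧
    (∀ i, w 0 i = (i : ℕ) + 1) ∧
    (∀ i, w (Fin.last N) i = y i) ∧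
    ∀ (t : Fin N) (i : Fin n),
      w t.succ i = w t.castSucc i ∨ w t.succ i = w t.castSucc i + 1}

/-- The kernel for densely packed walkers with end time `N` and endpoints `y`; here `i`, `j`, `l`
in `Fin n` stand for the indices `i + 1`, `j + 1`, `l + 1` in `1, …, n`. -/
noncomputable def walkKernel (n N : ℕ) (y : Fin n → ℤ) (r x s z : ℤ) : ℚ :=
  -phi r s x z +
    ∑ i : Fin n, ∑ j : Fin n,
      binom (N - r) (y i - x) * binom s (z - ((j : ℕ) + 1)) / binom (N + n - 1) (y i - 1) *
        ∑ k ∈ Finset.Icc 1 ((j : ℕ) + 1),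
          binom (N + n - 1) ((k : ℤ) - 1) *
            binom (N - 1 + ((j : ℕ) + 1) - k) (((j : ℕ) + 1) - k) *
            (-1) ^ (k + ((j : ℕ) + 1)) *
            ∏ l ∈ Finset.univ.erase i, ((k : ℚ) - y l) / ((y i : ℚ) - y l)

/-- The kernel of the half-hexagon of order `n`. -/
noncomputable def novakKernel (n : ℕ) (r x s y : ℤ) : ℚ :=
  -phi r s x y +
    ∑ i ∈ Finset.Icc 1 n, ∑ j ∈ Finset.Icc 1 n,
      binom (n + 1 - r) (2 * i - x) * binom s (y - j) / binom (2 * n) (2 * i - 1) *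
        ∑ k ∈ Finset.Icc 1 j,
          binom (2 * n) ((k : ℤ) - 1) * binom (n + j - k) ((j : ℤ) - k) *
            ((-1) ^ (k + j + i + n) /
              (2 ^ (n - 1) * (Nat.factorial (i - 1) : ℚ) * (Nat.factorial (n - i) : ℚ))) *
            ∏ l ∈ (Finset.Icc 1 n).erase i, ((k : ℚ) - 2 * l)

/-! ### Lozenge tilings

The vertices of the triangular lattice are written as pairs `(t, x)` of integers, in coordinates
in which the edges of the lattice have the directions `(0, 1)`, `(1, 0)` and `(1, 1)`. Every unit
triangle has exactly one vertical side, that is, a side of the direction `(0, 1)`. -/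

/-- The unit triangles of the triangular lattice. `opensRight t x` and `opensLeft t x` are the two
triangles with the vertical side from `(t, x)` to `(t, x + 1)`: the first one lies in the
strip between the abscissas `t` and `t + 1`, the second one in the strip between `t - 1` and `t`. -/
inductive Tri : Type
  | opensRight (t x : ℤ) : Tri
  | opensLeft (t x : ℤ) : Tri

/-- The three vertices of a unit triangle. -/
def Tri.vertices : Tri → Finset (ℤ × ℤ)
  | .opensRight t x => {(t, x), (t, x + 1), (t + 1, x + 1)}
  | .opensLeft t x => {(t, x), (t, x + 1), (t - 1, x)}

/-- A lozenge is the union of two distinct unit triangles that share a side, that is, two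
vertices. -/
def IsLozenge (q : Set Tri) : Prop :=
  ∃ a b : Tri, a ≠ b ∧ (a.vertices ∩ b.vertices).card = 2 ∧ q = {a, b}

/-- The half-hexagon of order `n`: the trapezoid with the corners `(0, 1)`, `(0, n + 1)`,
`(n + 1, 1)`, `(n + 1, 2 * n + 2)`, whose sides have the lengths `n`, `n + 1`, `2 * n + 1`, `n + 1`,
without the `n + 1` unit triangles that have the first, third, …, last unit segment of the long side
as a side. -/
def region (n : ℕ) : Set Tri :=
  {a | (∀ v ∈ a.vertices, 0 ≤ v.1 ∧ v.1 ≤ n + 1 ∧ 1 ≤ v.2 ∧ v.2 ≤ n + 1 + v.1) ∧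
    ∀ x : ℤ, Odd x → a ≠ .opensLeft (n + 1) x}

/-- The lozenge tilings of the half-hexagon of order `n`: the sets of lozenges inside the region
such that every unit triangle of the region belongs to exactly one of them. -/
def tilings (n : ℕ) : Set (Set (Set Tri)) :=
  {T | (∀ q ∈ T, IsLozenge q ∧ q ⊆ region n) ∧ ∀ a ∈ region n, ∃! q, q ∈ T ∧ a ∈ q}

/-- In the tiling `T` there is a walker at time `t` at position `x`: the vertical unit segment from
`(t, x)` to `(t, x + 1)` is a side of one of the lozenges of `T`, i.e. some lozenge contains exactly
one of the two unit triangles on this segment. (The lozenges with vertical sides are those swept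
by the walkers: they join the segment `(t, x)` to the segment `(t + 1, x)` or `(t + 1, x + 1)`. The
vertical segments that are not met by a walker are the diagonals of the other lozenges.) -/
def HasWalker (T : Set (Set Tri)) (t x : ℤ) : Prop :=
  ∃ q ∈ T, Xor (Tri.opensRight t x ∈ q) (Tri.opensLeft t x ∈ q)

end HalfHexagon

namespace HalfHexagon

/-! ### Binomial coefficients -/

/-! The heart is the statement on walkers; the half-hexagon follows from it by a bijection and an
explicit evaluation of the kernel.

Give each marked space-time point `a` the weight `1 + c a`. The weighted number of nonintersecting
configurations is a determinant of one-walker weights (`finsum_walks`, a Lindström–Gessel–Viennot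
formula). Splitting a single path at the last marked point chosen from its weights makes this
determinant `det A * det (1 + C * K)`, where `A` is the matrix of path numbers, `C` the diagonal
matrix of the `c a`, and `K` is built from the inverse of `A` (`det_pathWeight`). For `c` the
indicator of a set `S`, an alternating sum over `S` isolates the configurations that visit all the
marked points on one side and `K.det` on the other (`uniformProb_walks`).

The inverse of `A` is explicit (`pathMatrixInv_mul_pathMatrix`): dividing row `i` of `A` by `binom
(N + n - 1) (y i - 1)` leaves values at `y i` of polynomials of degree less than `n`. Lagrange
interpolation carries them to the nodes `1, …, n`, where the matrix becomes unitriangular Toeplitz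
with symbol `(1 + z)^N`, and is inverted by the coefficients of `(1 + z)^(-N)`.

For tilings, the vertical segments that are not diagonals of lozenges trace nonintersecting walkers,
and this correspondence is bijective (`image_tilingOfWalk`). The Novak kernel is the walk kernel
with the Lagrange denominators at the nodes `2, 4, …, 2n` evaluated (`novakKernel_eq_walkKernel`).
-/

lemma binom_of_neg {a b : ℤ} (h : b < 0) : binom a b = 0 := by
  simp [binom, not_le.mpr h]

lemma binom_natCast (a : ℤ) (b : ℕ) : binom a b = ((Ring.choose a b : ℤ) : ℚ) := by
  simp [binom]

lemma binom_natCast_natCast (a b : ℕ) : binom a b = (a.choose b : ℚ) := by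
  rw [binom_natCast, Ring.choose_natCast]; simp

lemma binom_zero_left (b : ℤ) : binom 0 b = if b = 0 then 1 else 0 := by
  rcases lt_or_ge b 0 with h | h
  · rw [binom_of_neg h, if_neg h.ne]
  · lift b to ℕ using h
    rw [binom_natCast]
    cases b with
    | zero => simp
    | succ k => rw [Ring.choose_zero_succ, if_neg (by omega)]; simp

lemma binom_add_one (a b : ℤ) : binom (a + 1) b = binom a b + binom a (b - 1) := by
  rcases lt_or_ge b 0 with h | h
  · rw [binom_of_neg h, binom_of_neg h, binom_of_neg (by omega), add_zero]
  · lift b to ℕ using h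
    cases b with
    | zero =>
      rw [binom_of_neg (b := ((0 : ℕ) : ℤ) - 1) (by simp), binom_natCast, binom_natCast]
      simp
    | succ k =>
      rw [show ((k + 1 : ℕ) : ℤ) - 1 = (k : ℕ) by push_cast; ring, binom_natCast, binom_natCast,
        binom_natCast, Ring.choose_succ_succ]
      push_cast; ring

/-! ### Weighted enumeration of walks -/

/-- The total weight of the paths of a single walker from `j` to `x` in time `t`, where a visit of
the site `u` at time `s < t` has the weight `f s u`. -/
def pathWeight (f : ℕ → ℤ → ℚ) : ℕ → ℤ → ℤ → ℚ
  | 0, j, x => if x = j then 1 else 0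
  | t + 1, j, x => f t x * pathWeight f t j x + f t (x - 1) * pathWeight f t j (x - 1)

/-- The positions one step before `y` if precisely the walkers outside `s` move in this step. -/
def stepBack {n : ℕ} (y : Fin n → ℤ) (s : Finset (Fin n)) : Fin n → ℤ :=
  s.piecewise y (fun i => y i - 1)

lemma stepBack_of_mem {n : ℕ} (y : Fin n → ℤ) {s : Finset (Fin n)} {i : Fin n} (h : i ∈ s) :
    stepBack y s i = y i := by simp [stepBack, h]

lemma stepBack_of_notMem {n : ℕ} (y : Fin n → ℤ) {s : Finset (Fin n)} {i : Fin n} (h : i ∉ s) :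
    stepBack y s i = y i - 1 := by simp [stepBack, h]

lemma stepBack_injective {n : ℕ} (y : Fin n → ℤ) : Function.Injective (stepBack y) := by
  intro s s' h
  ext i
  have := congrFun h i
  by_cases h1 : i ∈ s <;> by_cases h2 : i ∈ s' <;>
    simp [stepBack, h1, h2] at this ⊢
  omega

/-- Walkers at distinct sites can meet one step earlier but cannot cross. So an inadmissible
`stepBack y s` has two equal entries, which is what kills its determinant in `finsum_walks`. -/
lemma stepBack_monotone {n : ℕ} {y : Fin n → ℤ} (hy : StrictMono y) (s : Finset (Fin n)) :
    Monotone (stepBack y s) := by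
  intro i j hij
  rcases hij.eq_or_lt with rfl | hij
  · exact le_rfl
  · have := hy hij
    by_cases h1 : i ∈ s <;> by_cases h2 : j ∈ s <;> simp [stepBack, h1, h2] <;> omega

lemma walks_zero {n : ℕ} {y : Fin n → ℤ} :
    walks n 0 y ⊆ {fun _ => y} := by
  rintro w ⟨-, -, h, -⟩
  ext t i
  rw [← h, show t = Fin.last 0 from Fin.ext (by omega)]

lemma strictMono_of_walks_nonempty {n N : ℕ} {y : Fin n → ℤ} (h : (walks n N y).Nonempty) :
    StrictMono y := by
  obtain ⟨w, h1, -, h3, -⟩ := h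
  rw [← funext h3]
  exact h1 _

lemma walks_succ {n N : ℕ} {y : Fin n → ℤ} (hy : StrictMono y) :
    walks n (N + 1) y = ⋃ s : Finset (Fin n),
      (fun w : Fin (N + 1) → Fin n → ℤ => (Fin.snoc w y : Fin (N + 2) → Fin n → ℤ)) ''
        walks n N (stepBack y s) := by
  ext w
  simp only [Set.mem_iUnion, Set.mem_image]
  constructor
  · rintro ⟨h1, h2, h3, h4⟩
    refine ⟨Finset.univ.filter fun i => y i = w (Fin.last N).castSucc i, Fin.init w,
      ⟨fun t => h1 _, h2, fun i => ?_, fun t i => h4 t.castSucc i⟩, ?_⟩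
    · have h := h4 (Fin.last N) i
      rw [Fin.succ_last, h3] at h
      by_cases hi : y i = w (Fin.last N).castSucc i
      · rw [stepBack_of_mem _ (by simpa using hi)]; exact hi.symm
      · rw [stepBack_of_notMem _ (by simpa using hi)]
        simp only [Fin.init]; omega
    · rw [← funext h3]; exact Fin.snoc_init_self w
  · rintro ⟨s, v, ⟨h1, h2, h3, h4⟩, rfl⟩
    refine ⟨fun t => ?_, fun i => ?_, fun i => by simp, fun t i => ?_⟩
    · induction t using Fin.lastCases with
      | last => simpa using hy
      | cast t => simpa using h1 t
    · have := h2 i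
      rw [show (0 : Fin (N + 1 + 1)) = (0 : Fin (N + 1)).castSucc from rfl, Fin.snoc_castSucc]
      exact this
    · induction t using Fin.lastCases with
      | last =>
        rw [Fin.succ_last, Fin.snoc_last, Fin.snoc_castSucc, h3]
        by_cases hi : i ∈ s
        · simp [stepBack_of_mem _ hi]
        · simp [stepBack_of_notMem _ hi]
      | cast t =>
        rw [← Fin.castSucc_succ, Fin.snoc_castSucc, Fin.snoc_castSucc]
        exact h4 t i

lemma walks_finite (n N : ℕ) (y : Fin n → ℤ) : (walks n N y).Finite := by
  induction N generalizing y with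
  | zero => exact (Set.finite_singleton _).subset walks_zero
  | succ N ih =>
    by_cases hy : StrictMono y
    · rw [walks_succ hy]
      exact Set.finite_iUnion fun s => (ih _).image _
    · rw [Set.not_nonempty_iff_eq_empty.mp fun h => hy (strictMono_of_walks_nonempty h)]
      exact Set.finite_empty

/-- A permutation contributing to the determinant must be increasing, hence the identity. -/
lemma det_start {n : ℕ} {y : Fin n → ℤ} (hy : StrictMono y) :
    Matrix.det (Matrix.of fun j i : Fin n => if y j = (i : ℕ) + 1 then (1 : ℚ) else 0) =
      if y = (fun i : Fin n => ((i : ℕ) : ℤ) + 1) then 1 else 0 := by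
  split_ifs with h
  · refine (congrArg Matrix.det (Matrix.ext fun j i => ?_)).trans Matrix.det_one
    simp [h, Matrix.one_apply, Fin.ext_iff]
  · rw [Matrix.det_apply]
    refine Finset.sum_eq_zero fun σ _ => ?_
    suffices h0 : ∃ i, y (σ i) ≠ (i : ℕ) + 1 by
      obtain ⟨i, hi⟩ := h0
      rw [Finset.prod_eq_zero (Finset.mem_univ i) (by simp [hi]), smul_zero]
    by_contra! h0
    have hσ : StrictMono σ := by
      intro a b hab
      rw [← hy.lt_iff_lt, h0, h0]
      have : (a : ℕ) < b := hab
      omega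
    have : ⇑σ = id := by
      have e := Subsingleton.elim (StrictMono.orderIsoOfSurjective σ hσ σ.surjective)
        (OrderIso.refl _)
      funext i
      exact congrArg (fun e : Fin n ≃o Fin n => e i) e
    exact h (funext fun i => by simpa [this] using h0 i)

/-- Both sides satisfy the same recursion in the last step, so no sign-reversing involution is
needed. The factor `f N (y j)` supplies the final visit, which `pathWeight` leaves out. -/
theorem finsum_walks {n : ℕ} (f : ℕ → ℤ → ℚ) (N : ℕ) {y : Fin n → ℤ} (hy : StrictMono y) :
    ∑ᶠ w ∈ walks n N y, ∏ t : Fin (N + 1), ∏ i, f t (w t i) =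
      Matrix.det (Matrix.of fun j i : Fin n => f N (y j) * pathWeight f N ((i : ℕ) + 1) (y j)) := by
  induction N generalizing y with
  | zero =>
    rw [show (Matrix.of fun j i : Fin n => f 0 (y j) * pathWeight f 0 ((i : ℕ) + 1) (y j)) =
      Matrix.of fun j i : Fin n => f 0 (y j) *
        (Matrix.of fun j i : Fin n => if y j = (i : ℕ) + 1 then (1 : ℚ) else 0) j i from rfl,
      Matrix.det_mul_column, det_start hy]
    split_ifs with h
    · have : walks n 0 y = {fun _ => y} := by
        refine walks_zero.antisymm ?_
        rintro _ rfl
        exact ⟨fun _ => hy, fun i => congrFun h i, fun _ => rfl, fun t => t.elim0⟩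
      rw [this, finsum_mem_singleton]
      simp
    · have : walks n 0 y = ∅ := by
        rw [← Set.not_nonempty_iff_eq_empty]
        rintro ⟨w, h1, h2, h3, -⟩
        exact h (funext fun i => (h3 i).symm.trans (h2 i))
      rw [this, finsum_mem_empty, mul_zero]
  | succ N ih =>
    have inj : Function.Injective
        (fun w : Fin (N + 1) → Fin n → ℤ => (Fin.snoc w y : Fin (N + 2) → Fin n → ℤ)) :=
      fun w w' h => (Fin.snoc_inj.mp h).1
    rw [walks_succ hy, finsum_mem_iUnion _ fun s => (walks_finite _ _ _).image _,
      finsum_eq_sum_of_fintype]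
    · rw [show (Matrix.of fun j i : Fin n =>
          f (N + 1) (y j) * pathWeight f (N + 1) ((i : ℕ) + 1) (y j)) =
        Matrix.of fun j i : Fin n => f (N + 1) (y j) *
          (Matrix.of fun j i : Fin n => pathWeight f (N + 1) ((i : ℕ) + 1) (y j)) j i from rfl,
        Matrix.det_mul_column]
      -- By its recursion, each row of path weights is a sum of two rows, for staying and for
      -- moving; multilinearity expands the determinant over the sets `s` of walkers that stay.
      have key := (Matrix.detRowAlternating (n := Fin n) (R := ℚ)).toMultilinearMap.map_add_univ
        (fun j i => f N (y j) * pathWeight f N ((i : ℕ) + 1) (y j))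
        (fun j i => f N (y j - 1) * pathWeight f N ((i : ℕ) + 1) (y j - 1))
      change Matrix.det (Matrix.of fun j i : Fin n => pathWeight f (N + 1) ((i : ℕ) + 1) (y j)) = _
        at key
      rw [key, Finset.mul_sum]
      refine Finset.sum_congr rfl fun s _ => ?_
      rw [finsum_mem_image inj.injOn]
      simp only [Fin.prod_univ_castSucc (n := N + 1), Fin.snoc_castSucc, Fin.snoc_last,
        Fin.val_castSucc, Fin.val_last]
      have e : (Finset.piecewise s
          (fun j i => f N (y j) * pathWeight f N ((i : ℕ) + 1) (y j))
          (fun j i => f N (y j - 1) * pathWeight f N ((i : ℕ) + 1) (y j - 1)) :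
            Fin n → Fin n → ℚ) =
          fun j (i : Fin n) => f N (stepBack y s j) * pathWeight f N ((i : ℕ) + 1) (stepBack y s j) := by
        funext j
        by_cases hj : j ∈ s
        · simp [hj, stepBack_of_mem _ hj]
        · simp [hj, stepBack_of_notMem _ hj]
      rw [e]
      by_cases hs : StrictMono (stepBack y s)
      · simp only [mul_comm _ (∏ i, f (N + 1) (y i))]
        rw [← mul_finsum_mem' _ _ (walks_finite _ _ _), ih hs]
        rfl
      · rw [Set.not_nonempty_iff_eq_empty.mp fun h => hs (strictMono_of_walks_nonempty h),
          finsum_mem_empty]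
        -- No walk ends at colliding positions, and the determinant vanishes too because two of its
        -- rows agree.
        have : ¬ Function.Injective (stepBack y s) :=
          fun h => hs ((stepBack_monotone hy s).strictMono_of_injective h)
        obtain ⟨a, b, hab, hne⟩ := Function.not_injective_iff.mp this
        symm
        refine mul_eq_zero_of_right _ (AlternatingMap.map_eq_zero_of_eq _ _ ?_ hne)
        funext i
        simp only [hab]
    · intro s s' hne
      refine Set.disjoint_left.mpr ?_
      rintro _ ⟨w, hw, rfl⟩ ⟨w', hw', h⟩
      refine hne (stepBack_injective y ?_)
      rw [inj h] at hw'
      rw [← funext hw.2.2.1, ← funext hw'.2.2.1]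

/-! ### Correlation functions of walks -/

/-- The weight `1 + c a` at the space-time points `(τ a, ξ a)`, and `1` elsewhere. -/
def pointWeight {m : ℕ} (τ : Fin m → ℕ) (ξ : Fin m → ℤ) (c : Fin m → ℚ) (t : ℕ) (x : ℤ) : ℚ :=
  1 + ∑ a, if τ a = t ∧ ξ a = x then c a else 0

/-- Including the visit at time `t` itself turns the condition `τ a < t` of `phi` into `τ a ≤ t`,
since `binom 0` is a delta function. -/
lemma pointWeight_mul_pathWeight_of_pathWeight {m : ℕ} {τ : Fin m → ℕ} {ξ : Fin m → ℤ}
    {c : Fin m → ℚ} {t : ℕ} {j x : ℤ}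
    (h : pathWeight (pointWeight τ ξ c) t j x = binom t (x - j) +
      ∑ a, phi (τ a) t (ξ a) x * (c a * pathWeight (pointWeight τ ξ c) (τ a) j (ξ a))) :
    pointWeight τ ξ c t x * pathWeight (pointWeight τ ξ c) t j x = binom t (x - j) +
      ∑ a, if τ a ≤ t then binom (t - τ a) (x - ξ a) *
        (c a * pathWeight (pointWeight τ ξ c) (τ a) j (ξ a)) else 0 := by
  nth_rw 1 [pointWeight]
  rw [add_mul, one_mul, Finset.sum_mul]
  nth_rw 1 [h]
  rw [add_assoc, ← Finset.sum_add_distrib]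
  congr 1
  refine Finset.sum_congr rfl fun a _ => ?_
  rcases lt_trichotomy (τ a) t with h1 | h1 | h1
  · rw [if_neg (by omega), if_pos h1.le, phi, if_pos (by exact_mod_cast h1)]
    ring
  · subst h1
    rw [if_pos le_rfl, phi, if_neg (lt_irrefl _), sub_self, binom_zero_left]
    by_cases hx : ξ a = x
    · simp [hx]
    · rw [if_neg (by tauto), if_neg (by omega)]; ring
  · rw [if_neg (by omega), if_neg (by omega), phi, if_neg (by omega)]
    ring

/-- Expand the product of the factors `1 + c a` along a path and sort the terms by the last point
`a` at which `c a` is chosen: the path is free after it and fully weighted before it. The first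
summand collects the terms with no choice. -/
lemma pathWeight_pointWeight {m : ℕ} (τ : Fin m → ℕ) (ξ : Fin m → ℤ) (c : Fin m → ℚ)
    (t : ℕ) (j x : ℤ) :
    pathWeight (pointWeight τ ξ c) t j x = binom t (x - j) +
      ∑ a, phi (τ a) t (ξ a) x * (c a * pathWeight (pointWeight τ ξ c) (τ a) j (ξ a)) := by
  induction t generalizing x with
  | zero =>
    rw [Finset.sum_eq_zero fun a _ => by rw [phi, if_neg (by omega), zero_mul]]
    simp [pathWeight, binom_zero_left, sub_eq_zero]
  | succ t ih =>
    rw [pathWeight, pointWeight_mul_pathWeight_of_pathWeight (ih x),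
      pointWeight_mul_pathWeight_of_pathWeight (ih (x - 1)), add_add_add_comm,
      ← Finset.sum_add_distrib]
    congr 1
    · rw [Nat.cast_add, Nat.cast_one, binom_add_one, show x - 1 - j = x - j - 1 by ring]
    · refine Finset.sum_congr rfl fun a _ => ?_
      by_cases h : τ a ≤ t
      · rw [if_pos h, if_pos h, phi, if_pos (by omega), ← add_mul, Nat.cast_add, Nat.cast_one,
          show (t : ℤ) + 1 - τ a = t - τ a + 1 by ring, binom_add_one,
          show x - 1 - ξ a = x - ξ a - 1 by ring]
      · rw [if_neg h, if_neg h, phi, if_neg (by omega)]; ring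

/-- The matrix `C(N, y_j - i)` of the numbers of single paths. -/
noncomputable def pathMatrix (n N : ℕ) (y : Fin n → ℤ) : Matrix (Fin n) (Fin n) ℚ :=
  Matrix.of fun j i => binom N (y j - ((i : ℕ) + 1))

/-- The correlation kernel in terms of the (transposed) inverse `V` of `pathMatrix n N y`. -/
noncomputable def pathKernel {n : ℕ} (N : ℕ) (y : Fin n → ℤ) (V : Matrix (Fin n) (Fin n) ℚ)
    (r x s z : ℤ) : ℚ :=
  -phi r s x z +
    ∑ i : Fin n, ∑ j : Fin n, binom (N - r) (y i - x) * binom s (z - ((j : ℕ) + 1)) * V j i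

/-- Ordered by time, `1 - P` is block triangular with identity blocks on the diagonal. -/
lemma det_one_sub_eq_one {m : ℕ} (τ : Fin m → ℕ) (P : Matrix (Fin m) (Fin m) ℚ)
    (hP : ∀ a b, τ a ≤ τ b → P a b = 0) : (1 - P).det = 1 := by
  have hb : (1 - P).BlockTriangular (OrderDual.toDual ∘ τ) := by
    intro a b hab
    have hab : τ a < τ b := hab
    rw [Matrix.sub_apply, hP a b hab.le,
      Matrix.one_apply_ne (fun h => by simp [h] at hab), sub_zero]
  rw [hb.det]
  refine Finset.prod_eq_one fun k _ => ?_
  refine (congrArg Matrix.det (Matrix.ext fun a b => ?_)).trans Matrix.det_one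
  have hab : τ a = τ b := OrderDual.toDual.injective (a.2.trans b.2.symm)
  simp [Matrix.toSquareBlock_def, hP a b hab.le, Matrix.one_apply, Subtype.ext_iff]

lemma det_pathWeight {n N m : ℕ} (y : Fin n → ℤ) (V : Matrix (Fin n) (Fin n) ℚ)
    (hV : V * pathMatrix n N y = 1) (τ : Fin m → ℕ) (hτ : ∀ a, τ a ≤ N) (ξ : Fin m → ℤ)
    (c : Fin m → ℚ) :
    Matrix.det (Matrix.of fun j i : Fin n =>
      pointWeight τ ξ c N (y j) * pathWeight (pointWeight τ ξ c) N ((i : ℕ) + 1) (y j)) =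
    (pathMatrix n N y).det * Matrix.det (1 + Matrix.diagonal c *
      Matrix.of fun a b => pathKernel N y V (τ a) (ξ a) (τ b) (ξ b)) := by
  set A := pathMatrix n N y with hA
  set u : Matrix (Fin m) (Fin n) ℚ := Matrix.of fun a i =>
    pathWeight (pointWeight τ ξ c) (τ a) ((i : ℕ) + 1) (ξ a) with hu
  set C := Matrix.diagonal c
  set B : Matrix (Fin n) (Fin m) ℚ := Matrix.of fun j a => binom (N - τ a) (y j - ξ a) with hB
  set H : Matrix (Fin m) (Fin n) ℚ := Matrix.of fun a i =>
    binom (τ a) (ξ a - ((i : ℕ) + 1)) with hH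
  set P : Matrix (Fin m) (Fin m) ℚ := Matrix.of fun b a => phi (τ a) (τ b) (ξ a) (ξ b) with hP
  set K : Matrix (Fin m) (Fin m) ℚ :=
    Matrix.of fun a b => pathKernel N y V (τ a) (ξ a) (τ b) (ξ b) with hK
  have hM : (Matrix.of fun j i : Fin n =>
      pointWeight τ ξ c N (y j) * pathWeight (pointWeight τ ξ c) N ((i : ℕ) + 1) (y j)) =
      A + B * (C * u) := by
    ext j i
    rw [Matrix.of_apply, pointWeight_mul_pathWeight_of_pathWeight (pathWeight_pointWeight ..)]
    simp only [Matrix.add_apply, Matrix.mul_apply (M := B), C, Matrix.diagonal_mul]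
    simp [hA, hB, hu, pathMatrix, hτ]
  have hHu : (1 - P * C) * u = H := by
    rw [Matrix.sub_mul, Matrix.one_mul, sub_eq_iff_eq_add]
    ext a i
    simp only [Matrix.add_apply, Matrix.mul_assoc, Matrix.mul_apply (M := P), C,
      Matrix.diagonal_mul]
    exact pathWeight_pointWeight ..
  have hKt : K.transpose = -P + H * (V * B) := by
    ext b a
    simp only [Matrix.transpose_apply, hK, Matrix.of_apply, pathKernel, Matrix.add_apply,
      Matrix.neg_apply, hP, Matrix.mul_apply, hH, hB, Finset.mul_sum]
    rw [Finset.sum_comm]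
    congr 1
    refine Finset.sum_congr rfl fun j _ => Finset.sum_congr rfl fun i _ => ?_
    ring
  have hAV : A * V = 1 := mul_eq_one_comm.mp hV
  have h1 : (1 - P * C).det = 1 := by
    refine det_one_sub_eq_one τ _ fun a b hab => ?_
    rw [Matrix.mul_diagonal, hP, Matrix.of_apply, phi, if_neg (by omega), zero_mul]
  have h2 : A + B * (C * u) = A * (1 + (V * B * C) * u) := by
    rw [mul_add, mul_one]
    simp only [← Matrix.mul_assoc]
    rw [hAV, Matrix.one_mul]
  -- Sylvester's identity moves the second determinant to size `m`. Multiplying by `det (1 - P * C)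
  -- = 1` replaces the unknown `u` by the free path numbers `H`, leaving `1 - P * C + H * V * B *
  -- C`, the transpose of `1 + C * K`.
  rw [hM, h2, Matrix.det_mul, Matrix.det_one_add_mul_comm, ← one_mul (Matrix.det (1 + u * _)), ← h1,
    ← Matrix.det_mul, mul_add, mul_one, ← Matrix.mul_assoc, hHu,
    ← Matrix.det_transpose (1 + C * K), Matrix.transpose_add, Matrix.transpose_one,
    Matrix.transpose_mul, Matrix.diagonal_transpose, hKt, add_mul, Matrix.neg_mul]
  congr 2
  simp only [← Matrix.mul_assoc]
  abel

lemma prod_pointWeight {n N m : ℕ} {w : Fin (N + 1) → Fin n → ℤ} (hw : ∀ t, StrictMono (w t))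
    (t : Fin m → Fin (N + 1)) (x : Fin m → ℤ) (htx : Function.Injective fun a => (t a, x a))
    (c : Fin m → ℚ) [∀ a, Decidable (∃ i, w (t a) i = x a)] :
    ∏ s : Fin (N + 1), ∏ i, pointWeight (fun a => (t a : ℕ)) x c s (w s i) =
      ∏ a, (1 + if ∃ i, w (t a) i = x a then c a else 0) := by
  have h1 : ∀ (s : Fin (N + 1)) (z : ℤ), pointWeight (fun a => (t a : ℕ)) x c s z =
      ∏ a, (1 + if t a = s ∧ x a = z then c a else 0) := by
    intro s z
    simp only [pointWeight, ← Fin.ext_iff]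
    -- The marked points are distinct, so at most one summand is nonzero and the sum may be traded
    -- for a product.
    by_cases h : ∃ a, t a = s ∧ x a = z
    · obtain ⟨a, ha⟩ := h
      have hne : ∀ b, b ≠ a → ¬ (t b = s ∧ x b = z) := by
        rintro b hb ⟨h1, h2⟩
        exact hb (htx (by simp [ha.1, ha.2, h1, h2]))
      rw [Finset.sum_eq_single a (fun b _ hb => if_neg (hne b hb)) (by simp),
        Finset.prod_eq_single a (fun b _ hb => by rw [if_neg (hne b hb), add_zero]) (by simp)]
    · push Not at h
      rw [Finset.sum_eq_zero fun a _ => if_neg fun h' => h a h'.1 h'.2,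
        Finset.prod_eq_one fun a _ => by rw [if_neg fun h' => h a h'.1 h'.2, add_zero], add_zero]
  simp only [h1]
  simp only [Finset.prod_comm (s := Finset.univ (α := Fin n))]
  rw [Finset.prod_comm]
  refine Finset.prod_congr rfl fun a _ => ?_
  rw [Finset.prod_eq_single (t a) (fun s _ hs => Finset.prod_eq_one fun i _ => by
    rw [if_neg fun h => hs h.1.symm, add_zero]) (by simp)]
  split_ifs with h
  · obtain ⟨i, hi⟩ := h
    rw [Finset.prod_eq_single i (fun k _ hk => ?_) (by simp)]
    · simp [hi]
    · rw [if_neg fun h => hk ((hw (t a)).injective (h.2.symm.trans hi.symm)), add_zero]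
  · rw [add_zero]
    exact Finset.prod_eq_one fun i _ => by rw [if_neg fun h' => h ⟨i, h'.2.symm⟩, add_zero]

/-- Write each row of `K` as a row of `1 + K` plus a row of `-1` and expand; `S` is the set of rows
taken from `1 + K`. -/
lemma det_eq_sum_det_one_add {m : ℕ} (K : Matrix (Fin m) (Fin m) ℚ) :
    K.det = ∑ S : Finset (Fin m), (-1) ^ (Finset.univ \ S).card *
      (1 + Matrix.diagonal (fun a => if a ∈ S then 1 else 0) * K).det := by
  have key := (Matrix.detRowAlternating (n := Fin m) (R := ℚ)).toMultilinearMap.map_add_univ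
    (fun a b => (1 : Matrix (Fin m) (Fin m) ℚ) a b + K a b)
    (fun a b => -(1 : Matrix (Fin m) (Fin m) ℚ) a b)
  have h1 : ((fun a b => (1 : Matrix (Fin m) (Fin m) ℚ) a b + K a b) +
      (fun a b => -(1 : Matrix (Fin m) (Fin m) ℚ) a b) : Fin m → Fin m → ℚ) = fun a b => K a b := by
    funext a b
    simp
  rw [h1] at key
  refine key.trans ?_
  refine Finset.sum_congr rfl fun S _ => ?_
  have h2 := (Matrix.detRowAlternating (n := Fin m) (R := ℚ)).toMultilinearMap.map_piecewise_smul
    (fun _ => (-1 : ℚ))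
    (fun a b => (1 : Matrix (Fin m) (Fin m) ℚ) a b + (if a ∈ S then 1 else 0) * K a b)
    (Finset.univ \ S)
  rw [Finset.prod_const, smul_eq_mul] at h2
  have h3 : 1 + Matrix.diagonal (fun a => if a ∈ S then 1 else 0) * K =
      Matrix.of fun a b => (1 : Matrix (Fin m) (Fin m) ℚ) a b + (if a ∈ S then 1 else 0) * K a b := by
    refine Matrix.ext fun a b => ?_
    rw [Matrix.add_apply, Matrix.diagonal_mul, Matrix.of_apply]
  rw [h3]
  refine Eq.trans ?_ h2
  congr 1
  funext a b
  by_cases ha : a ∈ S <;> simp [Finset.piecewise, ha]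

theorem uniformProb_walks {n N : ℕ} {y : Fin n → ℤ} (hne : (walks n N y).Nonempty)
    (V : Matrix (Fin n) (Fin n) ℚ) (hV : V * pathMatrix n N y = 1)
    {m : ℕ} (t : Fin m → Fin (N + 1)) (x : Fin m → ℤ)
    (htx : Function.Injective fun a => (t a, x a)) :
    uniformProb (walks n N y) {w | ∀ a, ∃ i, w (t a) i = x a} =
      Matrix.det (Matrix.of fun a b : Fin m =>
        pathKernel N y V (t a : ℕ) (x a) (t b : ℕ) (x b)) := by
  classical
  have hy := strictMono_of_walks_nonempty hne
  have hfin := walks_finite n N y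
  set K : Matrix (Fin m) (Fin m) ℚ := Matrix.of fun a b : Fin m =>
        pathKernel N y V (t a : ℕ) (x a) (t b : ℕ) (x b)
  have hS : ∀ S : Finset (Fin m),
      ∑ w ∈ hfin.toFinset, ∏ a ∈ S, (1 + if ∃ i, w (t a) i = x a then (1 : ℚ) else 0) =
      (pathMatrix n N y).det *
        (1 + Matrix.diagonal (fun a => if a ∈ S then 1 else 0) * K).det := by
    intro S
    rw [← det_pathWeight y V hV (fun a => (t a : ℕ)) (fun a => by omega) x, ← finsum_walks _ _ hy,
      finsum_mem_eq_finite_toFinset_sum _ hfin]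
    refine Finset.sum_congr rfl fun w hw => ?_
    rw [prod_pointWeight ((hfin.mem_toFinset.mp hw).1) t x htx, ← Finset.prod_subset S.subset_univ]
    · exact Finset.prod_congr rfl fun a ha => by rw [if_pos ha]
    · intro a _ ha
      simp [ha]
  -- With no marked points all weights are 1, so the determinant counts the walks.
  have hcard : ((walks n N y).ncard : ℚ) = (pathMatrix n N y).det := by
    have := hS ∅
    simp only [Finset.prod_empty, Finset.sum_const, nsmul_eq_mul, mul_one, Finset.notMem_empty,
      if_false, Matrix.diagonal_zero, zero_mul, add_zero, Matrix.det_one] at this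
    rw [← this, Set.ncard_eq_toFinset_card _ hfin]
  have hcard' : ((walks n N y ∩ {w | ∀ a, ∃ i, w (t a) i = x a}).ncard : ℚ) =
      (pathMatrix n N y).det * K.det := by
    have h1 : walks n N y ∩ {w | ∀ a, ∃ i, w (t a) i = x a} =
        ((hfin.toFinset.filter fun w => ∀ a, ∃ i, w (t a) i = x a : Finset _) : Set _) := by
      ext w; simp
    rw [h1, Set.ncard_coe_finset, Finset.card_filter, Nat.cast_sum, det_eq_sum_det_one_add K,
      Finset.mul_sum]
    simp only [mul_left_comm (pathMatrix n N y).det, ← hS, Finset.mul_sum]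
    rw [Finset.sum_comm]
    refine Finset.sum_congr rfl fun w _ => ?_
    -- For a fixed walk the alternating sum over `S` is the product over `a` of `(1 + indicator) -
    -- 1`, the indicator of the event.
    have h2 := Finset.prod_add (fun a => 1 + if ∃ i, w (t a) i = x a then (1 : ℚ) else 0)
      (fun _ => -1) Finset.univ
    simp only [Finset.prod_const, Finset.powerset_univ] at h2
    simp only [mul_comm ((-1 : ℚ) ^ _)]
    rw [← h2]
    simp [Finset.prod_ite_zero]
  have hpos : ((walks n N y).ncard : ℚ) ≠ 0 := by
    have := (Set.ncard_pos hfin).mpr hne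
    positivity
  rw [uniformProb, hcard', hcard, mul_div_cancel_left₀]
  rwa [← hcard]

/-! ### The inverse of the matrix of path numbers -/

/-- Chu–Vandermonde for `N + (-N) = 0`, that is `(1 + z)^N * (1 + z)^(-N) = 1`, with the binomials
of `-N` rewritten by upper negation. -/
lemma sum_binom_mul_binom_neg (N d : ℕ) :
    ∑ l ∈ Finset.range (d + 1), binom N l *
      (binom (N - 1 + (d - l : ℕ)) (d - l : ℕ) * (-1) ^ (d - l)) = if d = 0 then 1 else 0 := by
  have h := Ring.add_choose_eq (r := (N : ℤ)) (s := -(N : ℤ)) d (Commute.all _ _)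
  rw [add_neg_cancel, Finset.Nat.sum_antidiagonal_eq_sum_range_succ_mk] at h
  have h' := congrArg (Int.cast : ℤ → ℚ) h
  rw [← binom_natCast, binom_zero_left, Int.cast_sum] at h'
  simp only [Nat.cast_eq_zero] at h'
  rw [h']
  refine Finset.sum_congr rfl fun l _ => ?_
  rw [binom_natCast, binom_natCast, Int.cast_mul, Ring.choose_neg]
  congr 1
  rw [Units.smul_def, smul_eq_mul, Int.cast_mul, mul_comm, Int.coe_negOnePow_natCast]
  push_cast
  congr 3
  ring

lemma sum_lagrange {n : ℕ} {v : Fin n → ℚ} (hv : Function.Injective v) (f : Polynomial ℚ)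
    (hf : f.degree < n) (u : ℚ) :
    ∑ i, f.eval (v i) * ∏ l ∈ Finset.univ.erase i, (u - v l) / (v i - v l) = f.eval u := by
  conv_rhs =>
    rw [Lagrange.eq_interpolate (s := Finset.univ) (v := v) (f := f) hv.injOn (by simpa using hf)]
  rw [Lagrange.interpolate_apply, Polynomial.eval_finsetSum]
  refine Finset.sum_congr rfl fun i _ => ?_
  rw [Polynomial.eval_mul, Polynomial.eval_C, Lagrange.basis, Polynomial.eval_prod]
  congr 1
  refine Finset.prod_congr rfl fun l _ => ?_
  simp [Lagrange.basisDivisor, div_eq_inv_mul]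

lemma factorial_mul_descFactorial_mul_choose (N : ℕ) {n j v : ℕ} (hj : j < n)
    (hv : v ≤ N + n - 1) :
    N.factorial * (v.descFactorial j * (N + n - 1 - v).descFactorial (n - 1 - j)) *
      (N + n - 1).choose v = (N + n - 1).factorial * if j ≤ v then N.choose (v - j) else 0 := by
  split_ifs with hjv
  · rcases le_or_gt (v - j) N with h | h
    · have h1 := Nat.factorial_mul_descFactorial hjv
      have h2 := Nat.factorial_mul_descFactorial (n := N + n - 1 - v) (k := n - 1 - j) (by omega)
      have h3 := Nat.choose_mul_factorial_mul_factorial hv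
      have h4 := Nat.choose_mul_factorial_mul_factorial h
      rw [show N + n - 1 - v - (n - 1 - j) = N - (v - j) by omega] at h2
      refine Nat.eq_of_mul_eq_mul_left (Nat.mul_pos (v - j).factorial_pos
        (N - (v - j)).factorial_pos) ?_
      calc _ = N.factorial * ((N + n - 1).choose v * ((v - j).factorial * v.descFactorial j) *
            ((N - (v - j)).factorial * (N + n - 1 - v).descFactorial (n - 1 - j))) := by ring
        _ = (N + n - 1).factorial * (N.choose (v - j) * (v - j).factorial *
            (N - (v - j)).factorial) := by rw [h1, h2, h3, h4, mul_comm]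
        _ = _ := by ring
    -- Here `N + n - 1 - v < n - 1 - j`, so the second falling factorial vanishes along with the
    -- binomial.
    · rw [Nat.choose_eq_zero_of_lt h, Nat.descFactorial_of_lt (n := N + n - 1 - v) (by omega)]
      simp
  · rw [Nat.descFactorial_of_lt (n := v) (by omega)]
    simp

open Polynomial in
/-- The quotients of binomial coefficients in the columns of the path matrix are values of
polynomials of degree less than `n`. -/
lemma exists_polynomial_eval_mul_binom (N : ℕ) {n : ℕ} (j : Fin n) :
    ∃ p : ℚ[X], p.degree < n ∧ ∀ v : ℤ, 1 ≤ v → v ≤ N + n →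
      p.eval (v : ℚ) * binom (N + n - 1) (v - 1) = binom N (v - ((j : ℕ) + 1)) := by
  -- Cancelling factorials in the quotient of the binomials leaves two falling factorials, of
  -- degrees `j` and `n - 1 - j`, in `v - 1` and `N + n - v`.
  refine ⟨C ((N.factorial : ℚ) / (N + n - 1).factorial) *
    ((descPochhammer ℚ j).comp (X - 1) *
      (descPochhammer ℚ (n - 1 - j)).comp (C ((N + n : ℕ) : ℚ) - X)), ?_, fun v h1 h2 => ?_⟩
  · refine lt_of_le_of_lt degree_le_natDegree ?_
    rw [Nat.cast_lt]
    refine (natDegree_C_mul_le _ _).trans_lt ?_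
    refine (natDegree_mul_le.trans (add_le_add natDegree_comp_le natDegree_comp_le)).trans_lt ?_
    rw [descPochhammer_natDegree, descPochhammer_natDegree]
    have h3 : (X - 1 : ℚ[X]).natDegree ≤ 1 := by compute_degree
    have h4 : (C ((N + n : ℕ) : ℚ) - X : ℚ[X]).natDegree ≤ 1 := by compute_degree
    have := Nat.mul_le_mul_left j.1 h3
    have := Nat.mul_le_mul_left (n - 1 - j.1) h4
    have := j.2
    omega
  · have hj := j.2
    obtain ⟨u, rfl⟩ : ∃ u : ℕ, v = u + 1 := ⟨(v - 1).toNat, by omega⟩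
    have hu : u ≤ N + n - 1 := by omega
    have key := factorial_mul_descFactorial_mul_choose N hj hu
    have e1 : ((u : ℤ) + 1 : ℤ) - 1 = (u : ℕ) := by ring
    have e2 : (N : ℤ) + n - 1 = (N + n - 1 : ℕ) := by omega
    rw [e1, e2, binom_natCast_natCast]
    have e3 : (((N + n : ℕ) : ℚ) - (((u : ℤ) + 1 : ℤ) : ℚ)) = ((N + n - 1 - u : ℕ) : ℚ) := by
      rw [show N + n - 1 - u = N + n - (u + 1) by omega, Nat.cast_sub (by omega)]; simp
    have e4 : ((((u : ℤ) + 1 : ℤ) : ℚ) - 1) = (u : ℚ) := by simp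
    rw [eval_mul, eval_C, eval_mul, eval_comp, eval_comp, eval_sub, eval_sub, eval_C, eval_X,
      eval_one, e3, e4, descPochhammer_eval_eq_descFactorial, descPochhammer_eval_eq_descFactorial]
    have e5 : binom N ((u : ℤ) + 1 - ((j : ℕ) + 1)) =
        ((if (j : ℕ) ≤ u then N.choose (u - j) else 0 : ℕ) : ℚ) := by
      split_ifs with h
      · rw [← binom_natCast_natCast]
        congr 1
        omega
      · rw [binom_of_neg (by omega), Nat.cast_zero]
    rw [e5, div_mul_eq_mul_div, div_mul_eq_mul_div, div_eq_iff (by positivity)]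
    rw [mul_comm _ (((N + n - 1).factorial : ℕ) : ℚ)]
    exact_mod_cast key

/-- The inverse of the path matrix. -/
noncomputable def pathMatrixInv (n N : ℕ) (y : Fin n → ℤ) : Matrix (Fin n) (Fin n) ℚ :=
  Matrix.of fun j i => (binom (N + n - 1) (y i - 1))⁻¹ *
    ∑ k ∈ Finset.Icc 1 ((j : ℕ) + 1),
      binom (N + n - 1) ((k : ℤ) - 1) *
        binom (N - 1 + ((j : ℕ) + 1) - k) (((j : ℕ) + 1) - k) *
        (-1) ^ (k + ((j : ℕ) + 1)) *
        ∏ l ∈ Finset.univ.erase i, ((k : ℚ) - y l) / ((y i : ℚ) - y l)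

lemma walkKernel_eq_pathKernel (n N : ℕ) (y : Fin n → ℤ) :
    walkKernel n N y = pathKernel N y (pathMatrixInv n N y) := by
  funext r x s z
  rw [walkKernel, pathKernel]
  congr 1
  refine Finset.sum_congr rfl fun i _ => Finset.sum_congr rfl fun j _ => ?_
  rw [pathMatrixInv, Matrix.of_apply, ← mul_assoc, div_eq_mul_inv]

/-- The sum over `i` is Lagrange interpolation of the column polynomial from the nodes `y i` to `k`.
The factor `binom (N + n - 1) (k - 1)` turns its value back into `binom N (k - (j + 1))`, and the
sum over `k` is then `sum_binom_mul_binom_neg`. The bounds on `y` keep the inverted binomials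
nonzero. -/
theorem pathMatrixInv_mul_pathMatrix {n N : ℕ} {y : Fin n → ℤ} (hy : Function.Injective y)
    (h1 : ∀ i, 1 ≤ y i) (h2 : ∀ i, y i ≤ N + n) :
    pathMatrixInv n N y * pathMatrix n N y = 1 := by
  refine Matrix.ext fun j' j => ?_
  obtain ⟨p, hdeg, hp⟩ := exists_polynomial_eval_mul_binom N j
  have hne : ∀ i, binom (N + n - 1) (y i - 1) ≠ 0 := by
    intro i
    have := h1 i
    have := h2 i
    rw [show (N : ℤ) + n - 1 = (N + n - 1 : ℕ) by omega,
      show y i - 1 = ((y i - 1).toNat : ℕ) by omega, binom_natCast_natCast, Nat.cast_ne_zero]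
    exact (Nat.choose_pos (by omega)).ne'
  have hlag := sum_lagrange (v := fun i => (y i : ℚ))
    (fun a b h => hy (Int.cast_injective h)) p hdeg
  have hy' : ∀ i, (binom (N + n - 1) (y i - 1))⁻¹ * binom N (y i - ((j : ℕ) + 1)) =
      p.eval (y i : ℚ) := by
    intro i
    rw [← hp _ (h1 i) (h2 i)]
    field_simp [hne i]
  have hterm : ∀ i, pathMatrixInv n N y j' i * pathMatrix n N y i j =
      ∑ k ∈ Finset.Icc 1 ((j' : ℕ) + 1),
      binom (N + n - 1) ((k : ℤ) - 1) *
        binom (N - 1 + ((j' : ℕ) + 1) - k) (((j' : ℕ) + 1) - k) *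
        (-1) ^ (k + ((j' : ℕ) + 1)) *
        (p.eval (y i : ℚ) * ∏ l ∈ Finset.univ.erase i, ((k : ℚ) - y l) / ((y i : ℚ) - y l)) := by
    intro i
    rw [pathMatrixInv, pathMatrix, Matrix.of_apply, Matrix.of_apply, mul_right_comm, hy',
      Finset.mul_sum]
    refine Finset.sum_congr rfl fun k _ => ?_
    ring
  rw [Matrix.mul_apply, Finset.sum_congr rfl fun i _ => hterm i, Finset.sum_comm]
  simp only [← Finset.mul_sum, hlag]
  have hj' := j'.2
  have hsum : ∀ k ∈ Finset.Icc 1 ((j' : ℕ) + 1), binom (N + n - 1) ((k : ℤ) - 1) *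
        binom (N - 1 + ((j' : ℕ) + 1) - k) (((j' : ℕ) + 1) - k) *
        (-1) ^ (k + ((j' : ℕ) + 1)) * p.eval (k : ℚ) =
      binom N ((k : ℤ) - ((j : ℕ) + 1)) *
        (binom (N - 1 + ((j' : ℕ) + 1) - k) (((j' : ℕ) + 1) - k) *
        (-1) ^ (k + ((j' : ℕ) + 1))) := by
    intro k hk
    rw [Finset.mem_Icc] at hk
    rw [← hp k (by omega) (by omega), Int.cast_natCast]
    ring
  rw [Finset.sum_congr rfl hsum, Matrix.one_apply]
  rcases lt_or_ge j' j with hlt | hle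
  · rw [if_neg hlt.ne]
    refine Finset.sum_eq_zero fun k hk => ?_
    rw [Finset.mem_Icc] at hk
    have : (j' : ℕ) < j := hlt
    rw [binom_of_neg (by omega), zero_mul]
  · have hle' : (j : ℕ) ≤ j' := hle
    have hd := sum_binom_mul_binom_neg N (j' - j)
    rw [show (if j' = j then (1 : ℚ) else 0) = if (j' : ℕ) - j = 0 then 1 else 0 from
      if_congr (by rw [Fin.ext_iff]; omega) rfl rfl, ← hd]
    symm
    -- The terms with `k ≤ j` vanish; the others are reindexed by `k = l + j + 1`.
    refine Finset.sum_of_injOn (fun l => l + j + 1) (fun a _ b _ h => by simpa using h)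
      (fun l hl => ?_) (fun k hk hk' => ?_) (fun l hl => ?_)
    · simp only [Finset.coe_range, Set.mem_Iio, Finset.coe_Icc, Set.mem_Icc] at hl ⊢
      omega
    · rw [Finset.mem_Icc] at hk
      rw [binom_of_neg, zero_mul]
      by_contra h
      exact hk' ⟨k - j - 1, by simp; omega, by simp; omega⟩
    · rw [Finset.mem_range] at hl
      congr 1
      · congr 1; push_cast; ring
      · congr 1
        · congr 1 <;> push_cast [show l ≤ (j' : ℕ) - j by omega, hle'] <;> ring
        · rw [show l + j + 1 + ((j' : ℕ) + 1) = (j' - j - l) + 2 * (l + j + 1) by omega, pow_add,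
            pow_mul]
          simp

lemma walks_bounds {n N : ℕ} {y : Fin n → ℤ} {w : Fin (N + 1) → Fin n → ℤ}
    (hw : w ∈ walks n N y) (t : Fin (N + 1)) (i : Fin n) :
    (i : ℕ) + 1 ≤ w t i ∧ w t i ≤ (i : ℕ) + 1 + (t : ℕ) := by
  obtain ⟨-, h0, -, hs⟩ := hw
  induction t using Fin.induction with
  | zero => simp [h0]
  | succ t ih =>
    rcases hs t i with h | h <;> rw [h] <;> simp only [Fin.val_castSucc, Fin.val_succ] at ih ⊢ <;>
      push_cast <;> omega

theorem uniformProb_walks_eq_det_walkKernel {n N : ℕ} {y : Fin n → ℤ}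
    (hne : (walks n N y).Nonempty) {m : ℕ} (t : Fin m → Fin (N + 1)) (x : Fin m → ℤ)
    (htx : Function.Injective fun a => (t a, x a)) :
    uniformProb (walks n N y) {w | ∀ a, ∃ i, w (t a) i = x a} =
      Matrix.det (Matrix.of fun a b : Fin m =>
        walkKernel n N y (t a : ℕ) (x a) (t b : ℕ) (x b)) := by
  rw [walkKernel_eq_pathKernel]
  refine uniformProb_walks hne _ (pathMatrixInv_mul_pathMatrix
    (strictMono_of_walks_nonempty hne).injective ?_ ?_) t x htx
  all_goals
    intro i
    obtain ⟨w, hw⟩ := hne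
    have h1 := walks_bounds hw (Fin.last N) i
    rw [hw.2.2.1, Fin.val_last] at h1
    omega

/-! ### The kernel of the half-hexagon -/

lemma sum_Icc_one_eq_sum_fin (n : ℕ) (f : ℕ → ℚ) :
    ∑ i ∈ Finset.Icc 1 n, f i = ∑ i : Fin n, f ((i : ℕ) + 1) := by
  rw [Fin.sum_univ_eq_sum_range (fun i => f (i + 1)), Finset.range_eq_Ico, Finset.sum_Ico_add']
  rfl

lemma prod_Icc_erase_eq_prod_fin_erase (n : ℕ) (i : Fin n) (f : ℕ → ℚ) :
    ∏ l ∈ (Finset.Icc 1 n).erase ((i : ℕ) + 1), f l =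
      ∏ l ∈ Finset.univ.erase i, f ((l : ℕ) + 1) := by
  symm
  refine Finset.prod_bij (fun l _ => (l : ℕ) + 1) ?_ ?_ ?_ ?_
  · intro l hl
    simp only [Finset.mem_erase, Finset.mem_univ, and_true, Finset.mem_Icc] at hl ⊢
    omega
  · intro a _ b _ h
    simpa [Fin.ext_iff] using h
  · intro b hb
    simp only [Finset.mem_erase, Finset.mem_Icc] at hb
    exact ⟨⟨b - 1, by omega⟩, by simp [Fin.ext_iff]; omega, by simp; omega⟩
  · intros; rfl

/-- The denominator in the Lagrange basis polynomials for the nodes `2, 4, …, 2 n`. -/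
lemma prod_fin_erase_two_mul_sub (n : ℕ) (i : Fin n) :
    ∏ l ∈ Finset.univ.erase i, (2 * ((i : ℕ) + 1 : ℚ) - 2 * ((l : ℕ) + 1)) =
      (-1) ^ (i + 1 + n) * (2 ^ (n - 1) * ((i : ℕ).factorial : ℚ) *
        ((n - (i + 1)).factorial : ℚ)) := by
  have h2 : ∀ l : Fin n, (2 * ((i : ℕ) + 1 : ℚ) - 2 * ((l : ℕ) + 1)) = 2 * ((i : ℚ) - (l : ℚ)) :=
    fun l => by ring
  simp only [h2]
  rw [Finset.prod_mul_distrib, Finset.prod_const, Finset.card_erase_of_mem (Finset.mem_univ i),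
    Finset.card_univ, Fintype.card_fin]
  have h3 : (Finset.univ.erase i : Finset (Fin n)) = Finset.Iio i ∪ Finset.Ioi i := by
    ext l; simp [lt_or_lt_iff_ne]
  have h4 : Disjoint (Finset.Iio i) (Finset.Ioi i) := by
    rw [Finset.disjoint_left]; intro l h h'
    simp only [Finset.mem_Iio, Finset.mem_Ioi] at h h'
    exact lt_asymm h h'
  have h5 : ∏ l ∈ Finset.Iio i, ((i : ℚ) - (l : ℚ)) = ((i : ℕ).factorial : ℚ) := by
    refine (Finset.prod_map (Finset.Iio i) Fin.valEmbedding
      (fun l : ℕ => (i : ℚ) - (l : ℚ))).symm.trans ?_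
    rw [Fin.map_valEmbedding_Iio, Nat.Iio_eq_range, ← Nat.descFactorial_self,
      Nat.descFactorial_eq_prod_range, Nat.cast_prod]
    refine Finset.prod_congr rfl fun l hl => ?_
    rw [Nat.cast_sub (Finset.mem_range.mp hl).le]
  have h6 : ∏ l ∈ Finset.Ioi i, ((i : ℚ) - (l : ℚ)) =
      (-1) ^ (n - (i + 1)) * ((n - (i + 1)).factorial : ℚ) := by
    refine (Finset.prod_map (Finset.Ioi i) Fin.valEmbedding
      (fun l : ℕ => (i : ℚ) - (l : ℚ))).symm.trans ?_
    rw [Fin.map_valEmbedding_Ioi, show Finset.Ioo (i : ℕ) n = Finset.Ico ((i : ℕ) + 1) n by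
        ext l; simp only [Finset.mem_Ioo, Finset.mem_Ico]; omega,
      Finset.prod_Ico_eq_prod_range, ← Finset.prod_range_add_one_eq_factorial, Nat.cast_prod]
    conv_rhs => rw [← Finset.card_range (n - (i + 1)), ← Finset.prod_const, Finset.card_range,
      ← Finset.prod_mul_distrib]
    refine Finset.prod_congr rfl fun l hl => ?_
    push_cast
    ring
  rw [h3, Finset.prod_union h4, h5, h6,
    show (i : ℕ) + 1 + n = (n - (i + 1)) + 2 * (i + 1) by omega, pow_add, pow_mul]
  ring

theorem novakKernel_eq_walkKernel (n : ℕ) (r x s z : ℤ) :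
    novakKernel n r x s z = walkKernel n (n + 1) (fun i => 2 * ((i : ℕ) + 1)) r x s z := by
  rw [novakKernel, walkKernel, sum_Icc_one_eq_sum_fin]
  congr 1
  refine Finset.sum_congr rfl fun i _ => ?_
  rw [sum_Icc_one_eq_sum_fin]
  refine Finset.sum_congr rfl fun j _ => ?_
  congr 1
  · push_cast
    congr 3
    ring
  · refine Finset.sum_congr rfl fun k _ => ?_
    rw [Finset.prod_div_distrib]
    push_cast
    rw [prod_fin_erase_two_mul_sub, prod_Icc_erase_eq_prod_fin_erase]
    push_cast
    rw [show (n : ℤ) + 1 + n - 1 = 2 * n by ring, show (n : ℤ) + 1 - 1 = n by ring,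
      show k + ((j : ℕ) + 1) + (i + 1) + n = k + (j + 1) + (i + 1 + n) by ring,
      pow_add (-1 : ℚ) (k + _) (i + 1 + n)]
    -- The sign of the Lagrange denominator is its own inverse, so it may stand in the numerator.
    rcases neg_one_pow_eq_or ℚ ((i : ℕ) + 1 + n) with h | h <;> rw [h] <;> field_simp

/-! ### Lozenges and tilings -/

/-- The two triangles `opensRight t x` and `opensLeft s y`. -/
def trianglePair (t x s y : ℤ) : Set Tri := {.opensRight t x, .opensLeft s y}

/-- The triangles `opensRight t x` and `opensLeft s y` share a side. -/
def ShareSide (t x s y : ℤ) : Prop := (s = t ∧ y = x) ∨ (s = t + 1 ∧ (y = x ∨ y = x + 1))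

lemma opensRight_mem_trianglePair {s y t x t' x' : ℤ} :
    Tri.opensRight s y ∈ trianglePair t x t' x' ↔ s = t ∧ y = x := by
  simp [trianglePair]

lemma opensLeft_mem_trianglePair {s y t x t' x' : ℤ} :
    Tri.opensLeft s y ∈ trianglePair t x t' x' ↔ s = t' ∧ y = x' := by
  simp [trianglePair]

lemma trianglePair_inj {t x t' x' s y s' y' : ℤ}
    (h : trianglePair t x t' x' = trianglePair s y s' y') :
    (t = s ∧ x = y) ∧ (t' = s' ∧ x' = y') := by
  refine ⟨?_, ?_⟩
  · rw [← opensRight_mem_trianglePair, ← h, opensRight_mem_trianglePair]; simp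
  · rw [← opensLeft_mem_trianglePair, ← h, opensLeft_mem_trianglePair]; simp

lemma exists_mem_vertices_of_card_eq_two {a b : Tri} (h : (a.vertices ∩ b.vertices).card = 2) :
    ∃ p₁ p₂ q₁ q₂ : ℤ, ¬ (p₁ = q₁ ∧ p₂ = q₂) ∧ (p₁, p₂) ∈ a.vertices ∧ (p₁, p₂) ∈ b.vertices ∧
      (q₁, q₂) ∈ a.vertices ∧ (q₁, q₂) ∈ b.vertices := by
  obtain ⟨⟨p₁, p₂⟩, hp, ⟨q₁, q₂⟩, hq, hne⟩ :=
    Finset.one_lt_card.mp (show 1 < (a.vertices ∩ b.vertices).card by omega)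
  rw [Finset.mem_inter] at hp hq
  exact ⟨p₁, p₂, q₁, q₂, by simpa using hne, hp.1, hp.2, hq.1, hq.2⟩

lemma shareSide_of_card_eq_two {t x t' x' : ℤ}
    (h : ((Tri.opensRight t x).vertices ∩ (Tri.opensLeft t' x').vertices).card = 2) :
    ShareSide t x t' x' := by
  obtain ⟨p₁, p₂, q₁, q₂, hne, h1, h2, h3, h4⟩ := exists_mem_vertices_of_card_eq_two h
  simp only [Tri.vertices, Finset.mem_insert, Finset.mem_singleton, Prod.mk.injEq] at h1 h2 h3 h4
  unfold ShareSide
  omega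

lemma card_eq_two_of_shareSide {t x t' x' : ℤ} (h : ShareSide t x t' x') :
    ((Tri.opensRight t x).vertices ∩ (Tri.opensLeft t' x').vertices).card = 2 := by
  rw [Finset.card_eq_two]
  rcases h with ⟨rfl, rfl⟩ | ⟨rfl, rfl | rfl⟩
  · refine ⟨(t', x'), (t', x' + 1), by simp, ?_⟩
    ext ⟨p, q⟩
    simp only [Tri.vertices, Finset.mem_inter, Finset.mem_insert, Finset.mem_singleton,
      Prod.mk.injEq]
    omega
  · refine ⟨(t, x'), (t + 1, x' + 1), by simp, ?_⟩
    ext ⟨p, q⟩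
    simp only [Tri.vertices, Finset.mem_inter, Finset.mem_insert, Finset.mem_singleton,
      Prod.mk.injEq]
    omega
  · refine ⟨(t, x + 1), (t + 1, x + 1), by simp, ?_⟩
    ext ⟨p, q⟩
    simp only [Tri.vertices, Finset.mem_inter, Finset.mem_insert, Finset.mem_singleton,
      Prod.mk.injEq]
    omega

/-- Two distinct triangles of the same orientation share at most one vertex, so a lozenge has one of
each. -/
lemma isLozenge_iff {q : Set Tri} :
    IsLozenge q ↔ ∃ t x t' x', ShareSide t x t' x' ∧ q = trianglePair t x t' x' := by
  constructor
  · rintro ⟨a, b, hab, hc, rfl⟩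
    rcases a with ⟨t, x⟩ | ⟨t, x⟩ <;> rcases b with ⟨t', x'⟩ | ⟨t', x'⟩
    · obtain ⟨p₁, p₂, q₁, q₂, hne, h1, h2, h3, h4⟩ := exists_mem_vertices_of_card_eq_two hc
      simp only [Tri.vertices, Finset.mem_insert, Finset.mem_singleton, Prod.mk.injEq]
        at h1 h2 h3 h4
      exact absurd (by simp only [Tri.opensRight.injEq]; omega) hab
    · exact ⟨t, x, t', x', shareSide_of_card_eq_two hc, rfl⟩
    · rw [Finset.inter_comm] at hc
      exact ⟨t', x', t, x, shareSide_of_card_eq_two hc, Set.pair_comm _ _⟩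
    · obtain ⟨p₁, p₂, q₁, q₂, hne, h1, h2, h3, h4⟩ := exists_mem_vertices_of_card_eq_two hc
      simp only [Tri.vertices, Finset.mem_insert, Finset.mem_singleton, Prod.mk.injEq]
        at h1 h2 h3 h4
      exact absurd (by simp only [Tri.opensLeft.injEq]; omega) hab
  · rintro ⟨t, x, t', x', h, rfl⟩
    exact ⟨_, _, by simp, card_eq_two_of_shareSide h, rfl⟩

lemma opensRight_mem_region {n : ℕ} {t x : ℤ} :
    Tri.opensRight t x ∈ region n ↔ 0 ≤ t ∧ t ≤ n ∧ 1 ≤ x ∧ x ≤ n + t := by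
  simp only [region, Tri.vertices, Set.mem_ofPred_eq, Finset.mem_insert, Finset.mem_singleton,
    forall_eq_or_imp, forall_eq, ne_eq, reduceCtorEq, not_false_eq_true, implies_true, and_true]
  omega

lemma opensLeft_mem_region {n : ℕ} {t x : ℤ} :
    Tri.opensLeft t x ∈ region n ↔
      1 ≤ t ∧ t ≤ n + 1 ∧ 1 ≤ x ∧ x ≤ n + t ∧ (t = n + 1 → ¬ Odd x) := by
  simp only [region, Tri.vertices, Set.mem_ofPred_eq, Finset.mem_insert, Finset.mem_singleton,
    forall_eq_or_imp, forall_eq, ne_eq, Tri.opensLeft.injEq, not_and]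
  constructor
  · rintro ⟨h, h'⟩
    exact ⟨by omega, by omega, by omega, by omega, fun ht hx => h' x hx ht rfl⟩
  · rintro ⟨h1, h2, h3, h4, h5⟩
    exact ⟨by omega, fun z hz ht hx => h5 ht (hx ▸ hz)⟩

/-! ### From tilings to walks -/

section Tiling

variable {n : ℕ} {T : Set (Set Tri)}

lemma exists_trianglePair_of_mem (hT : T ∈ tilings n) {q : Set Tri} (hq : q ∈ T) :
    ∃ t x t' x', ShareSide t x t' x' ∧ q = trianglePair t x t' x' :=
  isLozenge_iff.mp (hT.1 q hq).1

lemma exists_trianglePair_opensRight (hT : T ∈ tilings n) {t x : ℤ}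
    (h : Tri.opensRight t x ∈ region n) :
    ∃ t' x', ShareSide t x t' x' ∧ trianglePair t x t' x' ∈ T := by
  obtain ⟨q, ⟨hq, hm⟩, -⟩ := hT.2 _ h
  obtain ⟨s, y, s', y', hs, rfl⟩ := exists_trianglePair_of_mem hT hq
  obtain ⟨rfl, rfl⟩ := opensRight_mem_trianglePair.mp hm
  exact ⟨s', y', hs, hq⟩

lemma exists_trianglePair_opensLeft (hT : T ∈ tilings n) {t' x' : ℤ}
    (h : Tri.opensLeft t' x' ∈ region n) :
    ∃ t x, ShareSide t x t' x' ∧ trianglePair t x t' x' ∈ T := by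
  obtain ⟨q, ⟨hq, hm⟩, -⟩ := hT.2 _ h
  obtain ⟨s, y, s', y', hs, rfl⟩ := exists_trianglePair_of_mem hT hq
  obtain ⟨rfl, rfl⟩ := opensLeft_mem_trianglePair.mp hm
  exact ⟨s, y, hs, hq⟩

lemma eq_of_mem_of_mem (hT : T ∈ tilings n) {q q' : Set Tri} {a : Tri} (hq : q ∈ T) (hq' : q' ∈ T)
    (ha : a ∈ q) (ha' : a ∈ q') : q = q' :=
  (hT.2 a ((hT.1 q hq).2 ha)).unique ⟨hq, ha⟩ ⟨hq', ha'⟩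

lemma trianglePair_mem_opensRight (hT : T ∈ tilings n) {t x t' x' : ℤ}
    (h : trianglePair t x t' x' ∈ T) : Tri.opensRight t x ∈ region n :=
  (hT.1 _ h).2 (opensRight_mem_trianglePair.mpr ⟨rfl, rfl⟩)

lemma trianglePair_mem_opensLeft (hT : T ∈ tilings n) {t x t' x' : ℤ}
    (h : trianglePair t x t' x' ∈ T) : Tri.opensLeft t' x' ∈ region n :=
  (hT.1 _ h).2 (opensLeft_mem_trianglePair.mpr ⟨rfl, rfl⟩)

lemma opensLeft_unique (hT : T ∈ tilings n) {t x t' x' s' y' : ℤ}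
    (h : trianglePair t x t' x' ∈ T) (h' : trianglePair t x s' y' ∈ T) : t' = s' ∧ x' = y' :=
  (trianglePair_inj (eq_of_mem_of_mem hT h h' (opensRight_mem_trianglePair.mpr ⟨rfl, rfl⟩)
    (opensRight_mem_trianglePair.mpr ⟨rfl, rfl⟩))).2

lemma opensRight_unique (hT : T ∈ tilings n) {t x t' x' s y : ℤ}
    (h : trianglePair t x t' x' ∈ T) (h' : trianglePair s y t' x' ∈ T) : t = s ∧ x = y :=
  (trianglePair_inj (eq_of_mem_of_mem hT h h' (opensLeft_mem_trianglePair.mpr ⟨rfl, rfl⟩)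
    (opensLeft_mem_trianglePair.mpr ⟨rfl, rfl⟩))).1

/-- The smaller tiling already covers every triangle, which leaves no room for another lozenge. -/
lemma eq_of_subset {T' : Set (Set Tri)} (hT : T ∈ tilings n) (hT' : T' ∈ tilings n)
    (h : T ⊆ T') : T = T' := by
  refine h.antisymm fun q hq => ?_
  obtain ⟨t, x, t', x', -, rfl⟩ := exists_trianglePair_of_mem hT' hq
  obtain ⟨s', y', -, hs⟩ :=
    exists_trianglePair_opensRight hT (trianglePair_mem_opensRight hT' hq)
  obtain ⟨rfl, rfl⟩ := opensLeft_unique hT' hq (h hs)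
  exact hs

/-- The only lozenge with both triangles on the segment is `trianglePair t x t x`. If it is absent,
the lozenge covering either triangle in the region has the segment as a side. -/
lemma hasWalker_iff (hT : T ∈ tilings n) {t x : ℤ} :
    HasWalker T t x ↔ (Tri.opensRight t x ∈ region n ∨ Tri.opensLeft t x ∈ region n) ∧
      trianglePair t x t x ∉ T := by
  constructor
  · rintro ⟨q, hq, h⟩
    have hsub := (hT.1 q hq).2
    refine ⟨h.elim (fun h => Or.inl (hsub h.1)) (fun h => Or.inr (hsub h.1)), fun hv => ?_⟩
    rcases h with ⟨h, h'⟩ | ⟨h, h'⟩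
    · rw [eq_of_mem_of_mem hT hq hv h (by simp [trianglePair])] at h'
      exact h' (by simp [trianglePair])
    · rw [eq_of_mem_of_mem hT hq hv h (by simp [trianglePair])] at h'
      exact h' (by simp [trianglePair])
  · rintro ⟨h | h, hv⟩
    · obtain ⟨t', x', -, hq⟩ := exists_trianglePair_opensRight hT h
      refine ⟨_, hq, Or.inl ⟨by simp [trianglePair], fun h' => ?_⟩⟩
      obtain ⟨rfl, rfl⟩ := opensLeft_mem_trianglePair.mp h'
      exact hv hq
    · obtain ⟨t', x', -, hq⟩ := exists_trianglePair_opensLeft hT h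
      refine ⟨_, hq, Or.inr ⟨by simp [trianglePair], fun h' => ?_⟩⟩
      obtain ⟨rfl, rfl⟩ := opensRight_mem_trianglePair.mp h'
      exact hv hq

lemma hasWalker_zero_iff (hT : T ∈ tilings n) {x : ℤ} : HasWalker T 0 x ↔ 1 ≤ x ∧ x ≤ n := by
  rw [hasWalker_iff hT, opensRight_mem_region, opensLeft_mem_region]
  constructor
  · rintro ⟨h, -⟩; omega
  · intro h
    refine ⟨Or.inl (by omega), fun hv => ?_⟩
    have := opensLeft_mem_region.mp (trianglePair_mem_opensLeft hT hv)
    omega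

lemma hasWalker_last_iff (hT : T ∈ tilings n) {x : ℤ} :
    HasWalker T (n + 1) x ↔ 1 ≤ x ∧ x ≤ 2 * n + 1 ∧ ¬ Odd x := by
  rw [hasWalker_iff hT, opensRight_mem_region, opensLeft_mem_region]
  constructor
  · rintro ⟨h | h, -⟩
    · omega
    · exact ⟨h.2.2.1, by omega, h.2.2.2.2 rfl⟩
  · rintro ⟨h1, h2, h3⟩
    refine ⟨Or.inr ⟨by omega, by omega, h1, by omega, fun _ => h3⟩, fun hv => ?_⟩
    have := opensRight_mem_region.mp (trianglePair_mem_opensRight hT hv)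
    omega

open Classical in
/-- The position at time `t + 1` of the walker which is at `x` at time `t`. -/
noncomputable def nextPosition (T : Set (Set Tri)) (t x : ℤ) : ℤ :=
  if trianglePair t x (t + 1) x ∈ T then x else x + 1

lemma nextPosition_eq_or (T : Set (Set Tri)) (t x : ℤ) :
    nextPosition T t x = x ∨ nextPosition T t x = x + 1 := by
  unfold nextPosition; split_ifs <;> simp

lemma trianglePair_nextPosition_mem (hT : T ∈ tilings n) {t x : ℤ} (ht : t ≤ n)
    (h : HasWalker T t x) : trianglePair t x (t + 1) (nextPosition T t x) ∈ T := by
  obtain ⟨hr, hv⟩ := (hasWalker_iff hT).mp h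
  have hr : Tri.opensRight t x ∈ region n := by
    rcases hr with hr | hr
    · exact hr
    · rw [opensLeft_mem_region] at hr
      rw [opensRight_mem_region]
      omega
  obtain ⟨t', x', hs, hq⟩ := exists_trianglePair_opensRight hT hr
  unfold nextPosition
  split_ifs with hc
  · exact hc
  · rcases hs with ⟨rfl, rfl⟩ | ⟨rfl, rfl | rfl⟩
    · exact absurd hq hv
    · exact absurd hq hc
    · exact hq

lemma hasWalker_of_trianglePair_mem (hT : T ∈ tilings n) {t x x' : ℤ}
    (h : trianglePair t x (t + 1) x' ∈ T) : HasWalker T t x ∧ HasWalker T (t + 1) x' := by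
  rw [hasWalker_iff hT, hasWalker_iff hT]
  refine ⟨⟨Or.inl (trianglePair_mem_opensRight hT h), fun hv => ?_⟩,
    ⟨Or.inr (trianglePair_mem_opensLeft hT h), fun hv => ?_⟩⟩
  · have := opensLeft_unique hT h hv; omega
  · have := opensRight_unique hT h hv; omega

lemma exists_nextPosition_eq (hT : T ∈ tilings n) {t x' : ℤ} (ht : 0 ≤ t) (ht' : t ≤ n)
    (h : HasWalker T (t + 1) x') : ∃ x, HasWalker T t x ∧ nextPosition T t x = x' := by
  obtain ⟨hr, hv⟩ := (hasWalker_iff hT).mp h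
  have hl : Tri.opensLeft (t + 1) x' ∈ region n := by
    rcases hr with hr | hr
    · rw [opensRight_mem_region] at hr
      rw [opensLeft_mem_region]
      exact ⟨by omega, by omega, by omega, by omega, by omega⟩
    · exact hr
  obtain ⟨s, x, hs, hq⟩ := exists_trianglePair_opensLeft hT hl
  rcases hs with ⟨rfl, rfl⟩ | ⟨hs, -⟩
  · exact absurd hq hv
  · obtain rfl : t = s := by omega
    have hw := (hasWalker_of_trianglePair_mem hT hq).1
    exact ⟨x, hw, (opensLeft_unique hT (trianglePair_nextPosition_mem hT ht' hw) hq).2⟩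

/-- The walkers of a tiling. -/
noncomputable def walkOfTiling (n : ℕ) (T : Set (Set Tri)) : ℕ → Fin n → ℤ
  | 0, i => (i : ℕ) + 1
  | t + 1, i => nextPosition T t (walkOfTiling n T t i)

/-- Walkers are neither created nor destroyed: each occupied segment is joined to exactly one in the
next column, and conversely. -/
lemma walkOfTiling_spec (hT : T ∈ tilings n) (t : ℕ) (ht : t ≤ n + 1) :
    StrictMono (walkOfTiling n T t) ∧
      ∀ x, HasWalker T t x ↔ ∃ i, walkOfTiling n T t i = x := by
  induction t with
  | zero =>
    refine ⟨fun i j hij => ?_, fun x => ?_⟩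
    · have : (i : ℕ) < j := hij
      simp only [walkOfTiling]; omega
    · rw [Nat.cast_zero, hasWalker_zero_iff hT]
      simp only [walkOfTiling]
      constructor
      · intro h
        exact ⟨⟨(x - 1).toNat, by omega⟩, by simp; omega⟩
      · rintro ⟨i, rfl⟩
        omega
  | succ t ih =>
    obtain ⟨hm, hw⟩ := ih (by omega)
    have hw' : ∀ i, HasWalker T t (walkOfTiling n T t i) := fun i => (hw _).mpr ⟨i, rfl⟩
    have hp := fun i => trianglePair_nextPosition_mem hT (by omega) (hw' i)
    refine ⟨fun i j hij => ?_, fun x => ?_⟩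
    · simp only [walkOfTiling]
      have h1 := hm hij
      have h2 := nextPosition_eq_or T t (walkOfTiling n T t i)
      have h3 := nextPosition_eq_or T t (walkOfTiling n T t j)
      -- Two walkers arriving at the same segment would put its left triangle in two lozenges; since
      -- steps are 0 or 1, order is then preserved.
      have h4 : nextPosition T t (walkOfTiling n T t i) ≠
          nextPosition T t (walkOfTiling n T t j) := by
        intro h
        have h5 := hp i
        rw [h] at h5
        have := (opensRight_unique hT h5 (hp j)).2
        omega
      omega
    · rw [Nat.cast_add, Nat.cast_one]
      constructor
      · intro h
        obtain ⟨z, hz, rfl⟩ := exists_nextPosition_eq hT (by omega) (by omega) h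
        obtain ⟨i, rfl⟩ := (hw z).mp hz
        exact ⟨i, rfl⟩
      · rintro ⟨i, rfl⟩
        exact (hasWalker_of_trianglePair_mem hT (hp i)).2

/-- The endpoints `2, 4, …, 2 n`. -/
def evenEnds (n : ℕ) : Fin n → ℤ := fun i => 2 * ((i : ℕ) + 1)

lemma evenEnds_strictMono : StrictMono (evenEnds n) := by
  intro i j hij
  have : (i : ℕ) < j := hij
  simp only [evenEnds]; omega

lemma exists_evenEnds_eq_iff {x : ℤ} :
    (∃ i, evenEnds n i = x) ↔ 1 ≤ x ∧ x ≤ 2 * n + 1 ∧ ¬ Odd x := by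
  rw [Int.not_odd_iff_even]
  constructor
  · rintro ⟨i, rfl⟩
    simp only [evenEnds]
    exact ⟨by omega, by omega, even_two_mul _⟩
  · rintro ⟨h1, h2, k, rfl⟩
    exact ⟨⟨(k - 1).toNat, by omega⟩, by simp only [evenEnds]; omega⟩

lemma walkOfTiling_mem_walks (hT : T ∈ tilings n) :
    (fun t : Fin (n + 1 + 1) => walkOfTiling n T t) ∈ walks n (n + 1) (evenEnds n) := by
  refine ⟨fun t => (walkOfTiling_spec hT t (by omega)).1, fun i => rfl, fun i => ?_,
    fun t i => nextPosition_eq_or _ _ _⟩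
  obtain ⟨hm, hw⟩ := walkOfTiling_spec hT (n + 1) le_rfl
  refine congrFun ((hm.range_inj evenEnds_strictMono).mp ?_) i
  ext x
  rw [Set.mem_range, Set.mem_range, ← hw, exists_evenEnds_eq_iff, ← hasWalker_last_iff hT]
  simp

end Tiling

/-! ### The tiling of a walk -/

section Walk

variable {n : ℕ}

/-- There is a walker of `w` at time `t` at position `x`. -/
def Occupied (w : Fin (n + 1 + 1) → Fin n → ℤ) (t x : ℤ) : Prop :=
  ∃ s : Fin (n + 1 + 1), ((s : ℕ) : ℤ) = t ∧ ∃ i, w s i = x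

/-- The triangles `opensRight t x` and `opensLeft t' x'` are joined to a lozenge in the tiling of
`w`. -/
def Joined (w : Fin (n + 1 + 1) → Fin n → ℤ) (t x t' x' : ℤ) : Prop :=
  (t' = t + 1 ∧ ∃ (s : Fin (n + 1)) (i : Fin n),
    ((s : ℕ) : ℤ) = t ∧ w s.castSucc i = x ∧ w s.succ i = x') ∨
  (t' = t ∧ x' = x ∧ 1 ≤ t ∧ t ≤ n ∧ 1 ≤ x ∧ x ≤ n + t ∧ ¬ Occupied w t x)

/-- The tiling of a walk. -/
def tilingOfWalk (w : Fin (n + 1 + 1) → Fin n → ℤ) : Set (Set Tri) :=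
  {q | ∃ t x t' x', Joined w t x t' x' ∧ q = trianglePair t x t' x'}

variable {w : Fin (n + 1 + 1) → Fin n → ℤ}

lemma trianglePair_mem_tilingOfWalk {t x t' x' : ℤ} :
    trianglePair t x t' x' ∈ tilingOfWalk w ↔ Joined w t x t' x' := by
  constructor
  · rintro ⟨s, y, s', y', h, he⟩
    obtain ⟨⟨rfl, rfl⟩, rfl, rfl⟩ := trianglePair_inj he
    exact h
  · exact fun h => ⟨t, x, t', x', h, rfl⟩

lemma occupied_bounds (hw : w ∈ walks n (n + 1) (evenEnds n)) {t x : ℤ} (h : Occupied w t x) :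
    0 ≤ t ∧ t ≤ n + 1 ∧ 1 ≤ x ∧ x ≤ n + t := by
  obtain ⟨s, rfl, i, rfl⟩ := h
  have := walks_bounds hw s i
  omega

lemma occupied_zero (hw : w ∈ walks n (n + 1) (evenEnds n)) {x : ℤ} (h1 : 1 ≤ x) (h2 : x ≤ n) :
    Occupied w 0 x :=
  ⟨0, by simp, ⟨(x - 1).toNat, by omega⟩, by rw [hw.2.1]; simp; omega⟩

lemma occupied_last_iff (hw : w ∈ walks n (n + 1) (evenEnds n)) {x : ℤ} :
    Occupied w (n + 1) x ↔ 1 ≤ x ∧ x ≤ 2 * n + 1 ∧ ¬ Odd x := by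
  rw [← exists_evenEnds_eq_iff]
  constructor
  · rintro ⟨s, hs, i, rfl⟩
    obtain rfl : s = Fin.last (n + 1) := Fin.ext (by simp; omega)
    exact ⟨i, (hw.2.2.1 i).symm⟩
  · rintro ⟨i, rfl⟩
    exact ⟨Fin.last (n + 1), by simp, i, hw.2.2.1 i⟩

lemma joined_self_of_opensRight (hw : w ∈ walks n (n + 1) (evenEnds n)) {t x : ℤ}
    (h : Tri.opensRight t x ∈ region n) (ho : ¬ Occupied w t x) : Joined w t x t x := by
  rw [opensRight_mem_region] at h
  refine Or.inr ⟨rfl, rfl, ?_, by omega, by omega, by omega, ho⟩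
  by_contra h0
  obtain rfl : t = 0 := by omega
  exact ho (occupied_zero hw (by omega) (by omega))

lemma joined_self_of_opensLeft (hw : w ∈ walks n (n + 1) (evenEnds n)) {t x : ℤ}
    (h : Tri.opensLeft t x ∈ region n) (ho : ¬ Occupied w t x) : Joined w t x t x := by
  rw [opensLeft_mem_region] at h
  refine Or.inr ⟨rfl, rfl, by omega, ?_, by omega, by omega, ho⟩
  by_contra h0
  obtain rfl : t = n + 1 := by omega
  exact ho ((occupied_last_iff hw).mpr ⟨by omega, by omega, h.2.2.2.2 rfl⟩)

lemma exists_joined_succ {t x : ℤ} (ht : t ≤ n) (ho : Occupied w t x) :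
    ∃ x', Joined w t x (t + 1) x' := by
  obtain ⟨s, rfl, i, rfl⟩ := ho
  exact ⟨_, Or.inl ⟨rfl, ⟨s, by omega⟩, i, rfl, rfl, rfl⟩⟩

lemma exists_joined_pred {t x' : ℤ} (ht : 1 ≤ t) (ho : Occupied w t x') :
    ∃ x, Joined w (t - 1) x t x' := by
  obtain ⟨s, rfl, i, rfl⟩ := ho
  have hs : s ≠ 0 := by rintro rfl; simp at ht
  obtain ⟨r, rfl⟩ := Fin.exists_succ_eq.mpr hs
  exact ⟨w r.castSucc i, Or.inl ⟨by ring, r, i, by simp, rfl, rfl⟩⟩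

lemma Joined.shareSide (hw : w ∈ walks n (n + 1) (evenEnds n)) {t x t' x' : ℤ}
    (h : Joined w t x t' x') : ShareSide t x t' x' := by
  rcases h with ⟨rfl, s, i, rfl, rfl, rfl⟩ | ⟨h1, h2, -⟩
  · exact Or.inr ⟨rfl, hw.2.2.2 s i⟩
  · exact Or.inl ⟨h1, h2⟩

lemma Joined.opensRight_mem (hw : w ∈ walks n (n + 1) (evenEnds n)) {t x t' x' : ℤ}
    (h : Joined w t x t' x') : Tri.opensRight t x ∈ region n := by
  rw [opensRight_mem_region]
  rcases h with ⟨rfl, s, i, rfl, rfl, rfl⟩ | h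
  · have := occupied_bounds hw ⟨s.castSucc, rfl, i, rfl⟩
    simp only [Fin.val_castSucc] at this
    omega
  · omega

lemma Joined.opensLeft_mem (hw : w ∈ walks n (n + 1) (evenEnds n)) {t x t' x' : ℤ}
    (h : Joined w t x t' x') : Tri.opensLeft t' x' ∈ region n := by
  rw [opensLeft_mem_region]
  rcases h with ⟨rfl, s, i, rfl, rfl, rfl⟩ | h
  · have ho : Occupied w ((s : ℕ) + 1) (w s.succ i) := ⟨s.succ, by simp, i, rfl⟩
    have := occupied_bounds hw ho
    refine ⟨by omega, by omega, by omega, by omega, fun ht => ?_⟩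
    rw [ht] at ho
    exact ((occupied_last_iff hw).mp ho).2.2
  · exact ⟨by omega, by omega, by omega, by omega, by omega⟩

lemma Joined.left_unique (hw : w ∈ walks n (n + 1) (evenEnds n)) {t x t' x' s' y' : ℤ}
    (h : Joined w t x t' x') (h' : Joined w t x s' y') : t' = s' ∧ x' = y' := by
  rcases h with ⟨rfl, s, i, hs, hx, rfl⟩ | ⟨rfl, rfl, -, -, -, -, ho⟩ <;>
    rcases h' with ⟨rfl, r, k, hr, hx', rfl⟩ | ⟨rfl, rfl, -, -, -, -, ho'⟩
  · obtain rfl : s = r := Fin.ext (by omega)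
    rw [(hw.1 _).injective (hx.trans hx'.symm)]
    exact ⟨rfl, rfl⟩
  · exact absurd ⟨s.castSucc, hs, i, hx⟩ ho'
  · exact absurd ⟨r.castSucc, hr, k, hx'⟩ ho
  · exact ⟨rfl, rfl⟩

lemma Joined.right_unique (hw : w ∈ walks n (n + 1) (evenEnds n)) {t x t' x' s y : ℤ}
    (h : Joined w t x t' x') (h' : Joined w s y t' x') : t = s ∧ x = y := by
  rcases h with ⟨ht, p, i, hs, hx, hy⟩ | ⟨rfl, rfl, -, -, -, -, ho⟩ <;>
    rcases h' with ⟨ht', r, k, hr, hx', hy'⟩ | ⟨rfl, rfl, -, -, -, -, ho'⟩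
  · obtain rfl : p = r := Fin.ext (by omega)
    rw [← hx, ← hx', (hw.1 _).injective (hy.trans hy'.symm)]
    exact ⟨by omega, rfl⟩
  · exact absurd ⟨p.succ, by simp; omega, i, hy⟩ ho'
  · exact absurd ⟨r.succ, by simp; omega, k, hy'⟩ ho
  · exact ⟨rfl, rfl⟩

lemma tilingOfWalk_mem_tilings (hw : w ∈ walks n (n + 1) (evenEnds n)) :
    tilingOfWalk w ∈ tilings n := by
  refine ⟨?_, ?_⟩
  · rintro _ ⟨t, x, t', x', h, rfl⟩
    refine ⟨isLozenge_iff.mpr ⟨t, x, t', x', h.shareSide hw, rfl⟩, ?_⟩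
    rintro a (rfl | rfl)
    · exact h.opensRight_mem hw
    · exact h.opensLeft_mem hw
  · rintro (⟨t, x⟩ | ⟨t, x⟩) ha
    · obtain ⟨t', x', hj⟩ : ∃ t' x', Joined w t x t' x' := by
        by_cases ho : Occupied w t x
        · exact ⟨_, exists_joined_succ (opensRight_mem_region.mp ha).2.1 ho⟩
        · exact ⟨_, _, joined_self_of_opensRight hw ha ho⟩
      refine ⟨trianglePair t x t' x', ⟨⟨_, _, _, _, hj, rfl⟩, by simp [trianglePair]⟩, ?_⟩
      rintro _ ⟨⟨s, y, s', y', hj', rfl⟩, hm⟩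
      obtain ⟨rfl, rfl⟩ := opensRight_mem_trianglePair.mp hm
      obtain ⟨rfl, rfl⟩ := hj.left_unique hw hj'
      rfl
    · obtain ⟨s, y, hj⟩ : ∃ s y, Joined w s y t x := by
        by_cases ho : Occupied w t x
        · exact ⟨_, exists_joined_pred (opensLeft_mem_region.mp ha).1 ho⟩
        · exact ⟨_, _, joined_self_of_opensLeft hw ha ho⟩
      refine ⟨trianglePair s y t x, ⟨⟨_, _, _, _, hj, rfl⟩, by simp [trianglePair]⟩, ?_⟩
      rintro _ ⟨⟨s', y', t', x', hj', rfl⟩, hm⟩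
      obtain ⟨rfl, rfl⟩ := opensLeft_mem_trianglePair.mp hm
      obtain ⟨rfl, rfl⟩ := hj.right_unique hw hj'
      rfl

lemma hasWalker_tilingOfWalk_iff (hw : w ∈ walks n (n + 1) (evenEnds n)) {t x : ℤ} :
    HasWalker (tilingOfWalk w) t x ↔ Occupied w t x := by
  rw [hasWalker_iff (tilingOfWalk_mem_tilings hw), trianglePair_mem_tilingOfWalk]
  constructor
  · rintro ⟨hr, hj⟩
    by_contra ho
    exact hj (hr.elim (joined_self_of_opensRight hw · ho) (joined_self_of_opensLeft hw · ho))
  · intro ho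
    refine ⟨?_, ?_⟩
    · have hb := occupied_bounds hw ho
      by_cases ht : t ≤ n
      · exact Or.inl (opensRight_mem_region.mpr ⟨hb.1, ht, hb.2.2⟩)
      · obtain ⟨y, hy⟩ := exists_joined_pred (by omega) ho
        exact Or.inr (hy.opensLeft_mem hw)
    · rintro (⟨h, -⟩ | ⟨-, -, -, -, -, -, h⟩)
      · omega
      · exact h ho

lemma hasWalker_tilingOfWalk (hw : w ∈ walks n (n + 1) (evenEnds n)) (s : Fin (n + 1 + 1)) (x : ℤ) :
    HasWalker (tilingOfWalk w) (s : ℕ) x ↔ ∃ i, w s i = x := by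
  rw [hasWalker_tilingOfWalk_iff hw]
  constructor
  · rintro ⟨r, hr, h⟩
    obtain rfl : r = s := Fin.ext (by omega)
    exact h
  · exact fun h => ⟨s, rfl, h⟩

/-- The tiling records the occupied sites at each time, and a strictly increasing family is
determined by its range. -/
lemma tilingOfWalk_injOn : Set.InjOn (tilingOfWalk (n := n)) (walks n (n + 1) (evenEnds n)) := by
  intro w hw w' hw' h
  funext s
  refine ((hw.1 s).range_inj (hw'.1 s)).mp (Set.ext fun x => ?_)
  rw [Set.mem_range, Set.mem_range, ← hasWalker_tilingOfWalk hw, ← hasWalker_tilingOfWalk hw', h]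

lemma tilingOfWalk_walkOfTiling {T : Set (Set Tri)} (hT : T ∈ tilings n) :
    tilingOfWalk (fun t : Fin (n + 1 + 1) => walkOfTiling n T t) = T := by
  refine eq_of_subset (tilingOfWalk_mem_tilings (walkOfTiling_mem_walks hT)) hT ?_
  rintro _ ⟨t, x, t', x', ⟨rfl, s, i, rfl, rfl, rfl⟩ | ⟨rfl, rfl, h1, h2, h3, h4, ho⟩, rfl⟩
  · exact trianglePair_nextPosition_mem hT (by omega)
      (((walkOfTiling_spec hT s (by omega)).2 _).mpr ⟨i, rfl⟩)
  · by_contra hv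
    have hh := (hasWalker_iff hT).mpr
      ⟨Or.inl (opensRight_mem_region.mpr ⟨by omega, h2, h3, h4⟩), hv⟩
    lift t' to ℕ using by omega
    exact ho ⟨⟨t', by omega⟩, rfl, ((walkOfTiling_spec hT t' (by omega)).2 _).mp hh⟩

lemma image_tilingOfWalk : tilingOfWalk '' walks n (n + 1) (evenEnds n) = tilings n := by
  ext T
  constructor
  · rintro ⟨w, hw, rfl⟩
    exact tilingOfWalk_mem_tilings hw
  · exact fun hT => ⟨_, walkOfTiling_mem_walks hT, tilingOfWalk_walkOfTiling hT⟩

/-! ### Transfer of probabilities and existence of a tiling -/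

lemma uniformProb_tilings {m : ℕ} (t : Fin m → Fin (n + 1 + 1)) (x : Fin m → ℤ) :
    uniformProb (tilings n) {T | ∀ a, HasWalker T (t a : ℕ) (x a)} =
      uniformProb (walks n (n + 1) (evenEnds n)) {w | ∀ a, ∃ i, w (t a) i = x a} := by
  have h : tilings n ∩ {T | ∀ a, HasWalker T (t a : ℕ) (x a)} =
      tilingOfWalk '' (walks n (n + 1) (evenEnds n) ∩ {w | ∀ a, ∃ i, w (t a) i = x a}) := by
    rw [← image_tilingOfWalk]
    ext T
    constructor
    · rintro ⟨⟨w, hw, rfl⟩, h⟩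
      exact ⟨w, ⟨hw, fun a => (hasWalker_tilingOfWalk hw _ _).mp (h a)⟩, rfl⟩
    · rintro ⟨w, ⟨hw, h⟩, rfl⟩
      exact ⟨⟨w, hw, rfl⟩, fun a => (hasWalker_tilingOfWalk hw _ _).mpr (h a)⟩
  rw [uniformProb, uniformProb, h, ← image_tilingOfWalk, tilingOfWalk_injOn.ncard_image,
    (tilingOfWalk_injOn.mono Set.inter_subset_left).ncard_image]

lemma walks_evenEnds_nonempty (n : ℕ) : (walks n (n + 1) (evenEnds n)).Nonempty := by
  -- Each walker makes all of its `i + 1` moves at once and then rests at `2 * (i + 1)`.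
  refine ⟨fun t i => (i : ℕ) + 1 + (min (t : ℕ) ((i : ℕ) + 1) : ℕ), fun t i j hij => ?_, fun i => ?_,
    fun i => ?_, fun t i => ?_⟩
  · have : (i : ℕ) < j := hij
    simp only
    omega
  · simp
  · simp only [Fin.val_last, evenEnds]
    omega
  · simp only [Fin.val_succ, Fin.val_castSucc]
    omega

end Walk

end HalfHexagon

open HalfHexagon in
theorem corollary2 :
    -- the half-hexagon of order `n`
    (∀ n : ℕ, (tilings n).Finite ∧ (tilings n).Nonempty ∧
      ∀ (m : ℕ) (t : Fin m → Fin (n + 2)) (x : Fin m → ℤ),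
        Function.Injective (fun a => (t a, x a)) →
        uniformProb (tilings n) {T | ∀ a, HasWalker T (t a : ℕ) (x a)} =
          Matrix.det (Matrix.of fun a b : Fin m =>
            novakKernel n (t a : ℕ) (x a) (t b : ℕ) (x b))) ∧
    -- densely packed walkers with arbitrary end time and endpoints
    (∀ (n N : ℕ) (y : Fin n → ℤ), (walks n N y).Nonempty →
      (walks n N y).Finite ∧
      ∀ (m : ℕ) (t : Fin m → Fin (N + 1)) (x : Fin m → ℤ),
        Function.Injective (fun a => (t a, x a)) →
        uniformProb (walks n N y) {w | ∀ a, ∃ i, w (t a) i = x a} =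
          Matrix.det (Matrix.of fun a b : Fin m =>
            walkKernel n N y (t a : ℕ) (x a) (t b : ℕ) (x b))) ∧
    -- the first kernel is the second one for `N = n + 1` and `y_i = 2 i`
    (∀ (n : ℕ) (r x s z : ℤ),
      novakKernel n r x s z = walkKernel n (n + 1) (fun i => 2 * ((i : ℕ) + 1)) r x s z) := by
  refine ⟨fun n => ⟨?_, ?_, fun m t x htx => ?_⟩,
    fun n N y hne => ⟨walks_finite n N y, fun m t x htx =>
      uniformProb_walks_eq_det_walkKernel hne t x htx⟩, novakKernel_eq_walkKernel⟩
  · rw [← image_tilingOfWalk]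
    exact (walks_finite _ _ _).image _
  · rw [← image_tilingOfWalk]
    exact (walks_evenEnds_nonempty n).image _
  · refine (uniformProb_tilings t x).trans
      ((uniformProb_walks_eq_det_walkKernel (walks_evenEnds_nonempty n) t x htx).trans ?_)
    simp only [novakKernel_eq_walkKernel]
    rfl
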